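/- Let $q\in\mathbb C$ with $|q|>1$. Let $F$ be the field of meromorphic functions on $\mathbb C^*$, with the automorphism $\tau: f(x)\mapsto f(qx)$ and the derivation $\partial=x\,\frac{d}{dx}$, and let $k=F^\tau=\{f\in F: f(qx)=f(x)\}$. For a subfield $K\subseteq F$, an element $z\in F$ is called differentially algebraic over $K$ if there is an integer $m\ge 0$ such that $z,\partial z,\dots,\partial^m z$ are algebraically dependent over $K$. Let $a\in\mathbb C(x)$, $a\neq 0$, and let $z\in F$, $z\ne 0$, satisfy $z(qx)=a(x)z(x)$. Then: 1. $z$ is differentially algebraic over $\mathbb C(x)$ if and only if it is differentially algebraic over $k(x)$. 2. $z$ is differentially algebraic over $\mathbb C(x)$ if and only if there exist a nonzero $g\in\mathbb C(x)$, $n\in\mathbb Z$ and $c\in\mathbb C$ such that $a(x)=c\,x^n\,\frac{g(qx)}{g(x)}$. 3. Suppose moreover that $z$ is meromorphic on $\mathbb C$. Then $z$ is differentially algebraic over $\mathbb C(x)$ if and only if there exist a nonzero $g\in\mathbb C(x)$ and $c\in q^{\mathbb Z}$ such that $a(x)=c\,\frac{g(qx)}{g(x)}$; and in every representation $a(x)=c\,x^n\,\frac{g(qx)}{g(x)}$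 with $g\in\mathbb C(x)$ nonzero, $n\in\mathbb Z$ and $c\in\mathbb C$, one has $n=0$ and $c\in q^{\mathbb Z}$. -/

import Mathlib

open Filter Topology

/-- The `ℂ`-algebra of functions `ℂ → ℂ` that are meromorphic at every point of `ℂ* = ℂ \ {0}`
(Mathlib's convention: the values at the poles, and here also at `0`, are irrelevant). -/
def meroFun : Subalgebra ℂ (ℂ → ℂ) where
  carrier := {f | MeromorphicOn f {0}ᶜ}
  mul_mem' hf hg := MeromorphicOn.mul hf hg
  add_mem' hf hg := MeromorphicOn.add hf hg
  algebraMap_mem' c := MeromorphicOn.const c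

/-- The ideal of functions that vanish outside a closed discrete subset of `ℂ*`. -/
def meroNull : Ideal meroFun where
  carrier := {f | ∀ᶠ x in codiscreteWithin ({0}ᶜ : Set ℂ), f.1 x = 0}
  zero_mem' := by
    show ∀ᶠ x in codiscreteWithin ({0}ᶜ : Set ℂ), (0 : ℂ) = 0
    exact Eventually.of_forall fun _ => rfl
  add_mem' {f g} hf hg := by
    show ∀ᶠ x in codiscreteWithin ({0}ᶜ : Set ℂ), (f + g).1 x = 0
    filter_upwards [hf, hg] with x h1 h2
    show f.1 x + g.1 x = 0
    rw [h1, h2, add_zero]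
  smul_mem' c f hf := by
    show ∀ᶠ x in codiscreteWithin ({0}ᶜ : Set ℂ), (c • f).1 x = 0
    filter_upwards [hf] with x h1
    show c.1 x * f.1 x = 0
    rw [h1, mul_zero]

theorem mem_meroNull (f : meroFun) :
    f ∈ meroNull ↔ ∀ᶠ x in codiscreteWithin ({0}ᶜ : Set ℂ), f.1 x = 0 := Iff.rfl

theorem not_isDiscrete_puncturedPlane : ¬ IsDiscrete ({0}ᶜ : Set ℂ) := by
  intro h
  rw [isDiscrete_iff_nhdsNE] at h
  have h1 := h 1 (by simp)
  have hmem : ({0}ᶜ : Set ℂ) ∈ 𝓝[≠] (1 : ℂ) :=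
    mem_nhdsWithin_of_mem_nhds (isOpen_compl_singleton.mem_nhds (by simp))
  rw [inf_eq_left.2 (le_principal_iff.2 hmem)] at h1
  exact (NormedField.nhdsNE_neBot (1 : ℂ)).ne h1

theorem isPreconnected_puncturedPlane : IsPreconnected ({0}ᶜ : Set ℂ) :=
  (isConnected_compl_singleton_of_one_lt_rank
    (by rw [Complex.rank_real_complex]; norm_num) 0).isPreconnected

/-- Identity theorem: a nonzero meromorphic function on `ℂ*` is invertible. -/
instance meroNull_isMaximal : meroNull.IsMaximal := by
  rw [Ideal.isMaximal_iff]
  constructor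
  · intro h
    rw [mem_meroNull] at h
    have hb : codiscreteWithin ({0}ᶜ : Set ℂ) = ⊥ := by
      rw [← empty_mem_iff_bot]
      filter_upwards [h] with x hx
      exact absurd hx one_ne_zero
    exact not_isDiscrete_puncturedPlane (codiscreteWithin_eq_bot_iff.1 hb)
  · intro J f hJ hf hfJ
    have hfm : MeromorphicOn f.1 {0}ᶜ := f.2
    have hne : ∀ x ∈ ({0}ᶜ : Set ℂ), meromorphicOrderAt f.1 x ≠ ⊤ := by
      by_contra hcon
      push Not at hcon
      obtain ⟨y, hy, hy'⟩ := hcon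
      apply hf
      have htop : ∀ x ∈ ({0}ᶜ : Set ℂ), meromorphicOrderAt f.1 x = ⊤ := by
        intro x hx
        by_contra hx'
        exact hfm.meromorphicOrderAt_ne_top_of_isPreconnected isPreconnected_puncturedPlane
          hx hy hx' hy'
      rw [mem_meroNull, eventually_iff, mem_codiscreteWithin_iff_forall_mem_nhdsNE]
      intro x hx
      filter_upwards [meromorphicOrderAt_eq_top_iff.1 (htop x hx)] with w hw
      exact Or.inl hw
    let g : meroFun := ⟨f.1⁻¹, MeromorphicOn.inv hfm⟩
    have h1 : 1 - g * f ∈ meroNull := by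
      rw [mem_meroNull]
      filter_upwards [hfm.eventually_codiscreteWithin_apply_ne_zero hne] with x hx
      show 1 - (f.1 x)⁻¹ * f.1 x = 0
      rw [inv_mul_cancel₀ hx, sub_self]
    have h2 := J.add_mem (hJ h1) (J.mul_mem_left g hfJ)
    rwa [sub_add_cancel] at h2

/-- The field `F` of meromorphic functions on `ℂ*`: two functions are identified when they agree
outside a closed discrete subset of `ℂ*`. -/
abbrev MeroField : Type := meroFun ⧸ meroNull

noncomputable instance instFieldMeroField : Field MeroField := Ideal.Quotient.field meroNull

namespace MeroField

/-- The element of `F` given by a function that is meromorphic on `ℂ*`. -/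
noncomputable def mk (f : ℂ → ℂ) (hf : MeromorphicOn f {0}ᶜ) : MeroField :=
  Ideal.Quotient.mk meroNull ⟨f, hf⟩

theorem mk_eq_mk {f g : ℂ → ℂ} (hf : MeromorphicOn f {0}ᶜ) (hg : MeromorphicOn g {0}ᶜ) :
    mk f hf = mk g hg ↔ f =ᶠ[codiscreteWithin {0}ᶜ] g := by
  rw [mk, mk, Ideal.Quotient.eq, mem_meroNull]
  refine eventually_congr (Eventually.of_forall fun x => ?_)
  exact sub_eq_zero

/-- The coordinate function `x`. -/
noncomputable def X : MeroField := mk id MeromorphicOn.id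

/-- `z` is (the restriction to `ℂ*` of) a meromorphic function on `ℂ`. -/
def IsMeromorphicOnPlane (z : MeroField) : Prop :=
  ∃ (f : ℂ → ℂ) (hf : Meromorphic f), z = mk f hf.meromorphicOn

theorem meromorphicOn_comp_mul (q : ℂˣ) {f : ℂ → ℂ} (hf : MeromorphicOn f {0}ᶜ) :
    MeromorphicOn (fun x => f (q * x)) {0}ᶜ := by
  intro x hx
  have hx' : (q : ℂ) * x ∈ ({0}ᶜ : Set ℂ) := mul_ne_zero q.ne_zero hx
  exact MeromorphicAt.comp_analyticAt (g := fun x : ℂ => (q : ℂ) * x) (hf _ hx')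
    (analyticAt_const.mul analyticAt_id)

theorem tendsto_mul_codiscreteWithin (q : ℂˣ) :
    Tendsto (fun x : ℂ => (q : ℂ) * x) (codiscreteWithin {0}ᶜ) (codiscreteWithin {0}ᶜ) := by
  intro S hS
  rw [mem_codiscreteWithin_iff_forall_mem_nhdsNE] at hS
  rw [Filter.mem_map, mem_codiscreteWithin_iff_forall_mem_nhdsNE]
  intro x hx
  have hx' : (q : ℂ) * x ∈ ({0}ᶜ : Set ℂ) := mul_ne_zero q.ne_zero hx
  have ht : Tendsto (fun x : ℂ => (q : ℂ) * x) (𝓝[≠] x) (𝓝[≠] ((q : ℂ) * x)) := by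
    refine tendsto_nhdsWithin_iff.2 ⟨?_, ?_⟩
    · exact ((continuous_const_mul (q : ℂ)).tendsto x).mono_left nhdsWithin_le_nhds
    · filter_upwards [self_mem_nhdsWithin] with y hy
      exact fun h => hy (mul_left_cancel₀ q.ne_zero h)
  filter_upwards [ht (hS _ hx')] with y hy
  rcases hy with hy | hy
  · exact Or.inl hy
  · refine Or.inr fun h0 => hy (mul_ne_zero q.ne_zero h0)

/-- `f(x) ↦ f(qx)` on functions. -/
def funShift (q : ℂˣ) : meroFun →ₐ[ℂ] meroFun where
  toFun f := ⟨fun x => f.1 (q * x), meromorphicOn_comp_mul q f.2⟩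
  map_one' := rfl
  map_mul' _ _ := rfl
  map_zero' := rfl
  map_add' _ _ := rfl
  commutes' _ := rfl

/-- The operator `τ : f(x) ↦ f(qx)` on `F`. -/
noncomputable def qShift (q : ℂˣ) : MeroField →ₐ[ℂ] MeroField :=
  Ideal.quotientMapₐ meroNull (funShift q) fun _ hf =>
    (tendsto_mul_codiscreteWithin q).eventually hf

theorem qShift_mk (q : ℂˣ) (f : ℂ → ℂ) (hf : MeromorphicOn f {0}ᶜ) :
    qShift q (mk f hf) = mk (fun x => f (q * x)) (meromorphicOn_comp_mul q hf) := rfl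

theorem meromorphicOn_euler {f : ℂ → ℂ} (hf : MeromorphicOn f {0}ᶜ) :
    MeromorphicOn (fun x => x * deriv f x) {0}ᶜ :=
  MeromorphicOn.mul MeromorphicOn.id hf.deriv

/-- `f ↦ x f'(x)`, from functions to `F`. -/
noncomputable def funEuler : meroFun →ₗ[ℂ] MeroField where
  toFun f := mk (fun x => x * deriv f.1 x) (meromorphicOn_euler f.2)
  map_add' f g := by
    rw [mk, mk, mk, ← map_add, Ideal.Quotient.eq, mem_meroNull]
    filter_upwards [MeromorphicOn.eventually_codiscreteWithin_analyticAt f.1 f.2,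
      MeromorphicOn.eventually_codiscreteWithin_analyticAt g.1 g.2] with x hf hg
    show x * deriv (f.1 + g.1) x - (x * deriv f.1 x + x * deriv g.1 x) = 0
    rw [deriv_add hf.differentiableAt hg.differentiableAt]
    ring
  map_smul' c f := by
    show mk _ _ = Ideal.Quotient.mk meroNull (c • ⟨_, meromorphicOn_euler f.2⟩)
    rw [mk, Ideal.Quotient.eq, mem_meroNull]
    filter_upwards [MeromorphicOn.eventually_codiscreteWithin_analyticAt f.1 f.2] with x hf
    show x * deriv (c • f.1) x - c * (x * deriv f.1 x) = 0
    rw [deriv_const_smul c hf.differentiableAt, smul_eq_mul]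
    ring

theorem funEuler_eq_zero (f : meroFun) (hf : f ∈ meroNull) : funEuler f = 0 := by
  show Ideal.Quotient.mk meroNull _ = 0
  rw [Ideal.Quotient.eq_zero_iff_mem, mem_meroNull]
  have hU : IsOpen ({0}ᶜ : Set ℂ) := isOpen_compl_singleton
  rw [mem_meroNull, eventually_iff, mem_codiscreteWithin_iff_forall_mem_nhdsNE] at hf
  rw [eventually_iff, mem_codiscreteWithin_iff_forall_mem_nhdsNE]
  intro x hx
  have h1 : ∀ᶠ y in 𝓝[≠] x, f.1 y = 0 := by
    filter_upwards [hf x hx, mem_nhdsWithin_of_mem_nhds (hU.mem_nhds hx)] with y hy hy0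
    rcases hy with hy | hy
    · exact hy
    · exact absurd hy0 hy
  filter_upwards [eventually_eventually_nhdsWithin.2 h1, self_mem_nhdsWithin] with y hy hyx
  left
  show y * deriv f.1 y = 0
  have this : f.1 =ᶠ[𝓝 y] fun _ => (0 : ℂ) := by
    rw [isOpen_compl_singleton.nhdsWithin_eq hyx] at hy
    exact hy
  rw [this.deriv_eq]
  simp

theorem funEuler_mul (f g : meroFun) :
    funEuler (f * g) = Ideal.Quotient.mk meroNull f * funEuler g
      + Ideal.Quotient.mk meroNull g * funEuler f := by
  show Ideal.Quotient.mk meroNull _ = _ * Ideal.Quotient.mk meroNull _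
    + _ * Ideal.Quotient.mk meroNull _
  rw [← map_mul, ← map_mul, ← map_add, Ideal.Quotient.eq, mem_meroNull]
  filter_upwards [MeromorphicOn.eventually_codiscreteWithin_analyticAt f.1 f.2,
    MeromorphicOn.eventually_codiscreteWithin_analyticAt g.1 g.2] with x hf hg
  show x * deriv (f.1 * g.1) x - (f.1 x * (x * deriv g.1 x) + g.1 x * (x * deriv f.1 x)) = 0
  rw [deriv_mul hf.differentiableAt hg.differentiableAt]
  ring

/-- The derivation `∂ = x d/dx` on `F`. -/
noncomputable def euler : Derivation ℂ MeroField MeroField :=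
  Derivation.mk'
    (Submodule.liftQ (meroNull.restrictScalars ℂ) funEuler fun f hf => funEuler_eq_zero f hf)
    (by
      intro f g
      obtain ⟨f, rfl⟩ := Ideal.Quotient.mk_surjective f
      obtain ⟨g, rfl⟩ := Ideal.Quotient.mk_surjective g
      exact funEuler_mul f g)

theorem euler_mk (f : ℂ → ℂ) (hf : MeromorphicOn f {0}ᶜ) :
    euler (mk f hf) = mk (fun x => x * deriv f x) (meromorphicOn_euler hf) := rfl

/-- The subfield `ℂ(x)` of `F`. -/
noncomputable def ratField : IntermediateField ℂ MeroField := IntermediateField.adjoin ℂ {X}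

/-- The field of constants `k = F^τ`: the `q`-elliptic functions. -/
noncomputable def ellipticField (q : ℂˣ) : Subfield MeroField :=
  RingHom.eqLocusField (qShift q : MeroField →+* MeroField) (RingHom.id MeroField)

/-- The subfield `k(x)` of `F`. -/
noncomputable def ellipticRatField (q : ℂˣ) : IntermediateField (ellipticField q) MeroField :=
  IntermediateField.adjoin (ellipticField q) {X}

/-- `z` is differentially algebraic over `K` with respect to `∂`: for some `n ≥ 0` the functions
`z, ∂z, …, ∂ⁿz` are algebraically dependent over `K`. -/
def IsDifferentiallyAlgebraic (K : Type) [Field K] [Algebra K MeroField] (z : MeroField) : Prop :=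
  ∃ n : ℕ, ¬ AlgebraicIndependent K fun i : Fin (n + 1) => (euler^[i]) z

end MeroField

/-! Call `a` a twist if `a = c xⁿ τ(g)/g` with `g` a nonzero rational function and `c ≠ 0`.
Differential algebraicity of `z`, over `ℂ(x)` or over `k(x)`, is shown to be equivalent to `a` being
a twist.

The link is a condition over `ℂ` alone: `z` is algebraic over `ℂ(S)` for a finite set `S` such that
the relative algebraic closure of `ℂ(S)` in `F` is stable under `∂`. Passing to it from `k(x)` loses
nothing because `k` has transcendence degree at most one over `ℂ`: the elliptic functions with
bounded poles form a space whose dimension grows at most linearly in the bound, whereas the number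
of monomials in two functions grows quadratically (`not_algebraicIndependent_of_mem_ellipticField`).

Given such an `S`, put `u = ∂z/z`. Then `τ(∂ⁱu) = ∂ⁱu + ∂ⁱ(∂a/a)`, and more than `|S|` of the `∂ⁱu`
are algebraically dependent over `ℂ(x)`. An Ostrowski-type argument
(`exists_linear_of_not_algebraicIndependent`) turns this dependence into a relation `L(∂a/a) = τ(h)
- h`, with `h` rational and `L ≠ 0` a differential operator whose coefficients are `τ`-invariant
rational functions, hence complex numbers. Twists can be used to gather the zeros and poles of `a`
in each `q`-orbit of `ℂ*` at one point. If any remained, `L(∂a/a)` would have exactly one pole in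
that orbit, and `h` would then have infinitely many (`support_subset_of_isTelescoping`). So only a
monomial remains, and `a` is a twist.

Conversely, if `a` is a twist, then `w = z/g` satisfies `τ(w) = c xⁿ w`, so `∂w/w` is shifted by the
constant `n` and `∂(∂w/w)` is elliptic. Finitely many functions therefore suffice for `S`.

If `z` is meromorphic at `0` too, so is `w`, and comparing leading terms there in `w(qx) = c xⁿ
w(x)` gives `n = 0` and `c = qᵏ`, where `k` is the order of `w` at `0`. -/

/-! ### Relative algebraic closure, transcendence degree and derivations. -/

section RelativeAlgebraicClosure

variable (k : Type*) {E : Type*} [Field k] [Field E] [Algebra k E]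

/-- The relative algebraic closure in `E` of the field generated by `T` over `k`. -/
noncomputable def algClosureAdjoin (T : Set E) : IntermediateField k E :=
  (algebraicClosure (IntermediateField.adjoin k T) E).restrictScalars k

variable {k}

theorem mem_algClosureAdjoin {T : Set E} {y : E} :
    y ∈ algClosureAdjoin k T ↔ IsAlgebraic (IntermediateField.adjoin k T) y := by
  rw [algClosureAdjoin, IntermediateField.mem_restrictScalars, mem_algebraicClosure_iff]

theorem mem_algClosureAdjoin_iff {T : Set E} {y : E} :
    y ∈ algClosureAdjoin k T ↔ IsAlgebraic (Algebra.adjoin k T) y := by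
  rw [mem_algClosureAdjoin, IntermediateField.isAlgebraic_adjoin_iff]

theorem adjoin_le_algClosureAdjoin (T : Set E) :
    IntermediateField.adjoin k T ≤ algClosureAdjoin k T := fun y hy =>
  mem_algClosureAdjoin.2 (isAlgebraic_algebraMap (⟨y, hy⟩ : IntermediateField.adjoin k T))

theorem subset_algClosureAdjoin (T : Set E) : T ⊆ algClosureAdjoin k T :=
  (IntermediateField.subset_adjoin k T).trans (adjoin_le_algClosureAdjoin T)

/-- Transitivity of algebraicity. No `k`-algebra structure on `R` is required, so it applies to
rings generated over a larger field `K` that is only known to land in the closure. -/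
theorem mem_algClosureAdjoin_of_isAlgebraic {T : Set E} {R : Type*} [CommRing R] [Algebra R E]
    (hinj : Function.Injective (algebraMap R E))
    (hR : ∀ r : R, algebraMap R E r ∈ algClosureAdjoin k T) {y : E} (hy : IsAlgebraic R y) :
    y ∈ algClosureAdjoin k T := by
  let f : R →+* algebraicClosure (IntermediateField.adjoin k T) E :=
    (algebraMap R E).codRestrict _ hR
  have hf : Function.Injective f := fun a b hab => hinj (congrArg Subtype.val hab)
  have h1 : IsAlgebraic (algebraicClosure (IntermediateField.adjoin k T) E) y := by
    obtain ⟨p, hp, hpy⟩ := hy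
    refine ⟨p.map f, (Polynomial.map_ne_zero_iff hf).2 hp, ?_⟩
    rw [Polynomial.aeval_def, Polynomial.eval₂_map]
    exact hpy
  exact mem_algClosureAdjoin.2 (h1.restrictScalars (IntermediateField.adjoin k T))

theorem algClosureAdjoin_le {S T : Set E} (h : S ⊆ algClosureAdjoin k T) :
    algClosureAdjoin k S ≤ algClosureAdjoin k T := by
  have h1 : IntermediateField.adjoin k S ≤ algClosureAdjoin k T :=
    IntermediateField.adjoin_le_iff.2 h
  exact fun y hy => mem_algClosureAdjoin_of_isAlgebraic Subtype.val_injective (fun r => h1 r.2)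
    (mem_algClosureAdjoin.1 hy)

theorem algClosureAdjoin_eq_matroid_closure (T : Set E) :
    (algClosureAdjoin k T : Set E) = (AlgebraicIndependent.matroid k E).closure T := by
  rw [AlgebraicIndependent.matroid_closure_eq]
  ext y
  rw [SetLike.mem_coe, mem_algClosureAdjoin_iff]
  rfl

/-- In the matroid of algebraic independence a set and its closure have the same rank, and the rank
of `T` is at most its cardinality. -/
theorem AlgebraicIndependent.card_le_of_mem_algClosureAdjoin {n : ℕ} {v : Fin n → E}
    (hv : AlgebraicIndependent k v) {T : Set E} (hvT : ∀ i, v i ∈ algClosureAdjoin k T) :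
    (n : ℕ∞) ≤ T.encard := by
  have h1 : (AlgebraicIndependent.matroid k E).Indep (Set.range v) :=
    AlgebraicIndependent.matroid_indep_iff.2 hv.coe_range
  have h2 : Set.range v ⊆ (AlgebraicIndependent.matroid k E).closure T := by
    rw [← algClosureAdjoin_eq_matroid_closure]
    rintro _ ⟨i, rfl⟩
    exact hvT i
  have h3 := h1.encard_le_eRk_of_subset h2
  rw [Matroid.eRk_closure_eq] at h3
  have h4 : (Set.range v).encard = n := by
    rw [← Set.image_univ, hv.injective.encard_image, Set.encard_univ]
    simp
  rw [← h4]
  exact h3.trans ((AlgebraicIndependent.matroid k E).eRk_le_encard T)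

theorem exists_isAlgebraic_adjoin_of_not_algebraicIndependent {v : ℕ → E} {n : ℕ}
    (h : ¬ AlgebraicIndependent k fun i : Fin n => v i) :
    ∃ j < n, IsAlgebraic (Algebra.adjoin k (v '' Set.Iio j)) (v j) := by
  by_contra! hcon
  apply h
  have h1 : ∀ m ≤ n, AlgebraicIndepOn k v (Set.Iio m) := by
    intro m hm
    induction m with
    | zero =>
      have : IsEmpty (Set.Iio (0 : ℕ)) := by simp
      exact algebraicIndependent_empty_type_iff.2 (algebraMap k E).injective
    | succ m ih =>
      have := (ih (by omega)).insert (hcon m (by omega))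
      rwa [show insert m (Set.Iio m) = Set.Iio (m + 1) from by
        ext i
        simp only [Set.mem_insert_iff, Set.mem_Iio]
        omega] at this
  exact (h1 n le_rfl).comp (fun i : Fin n => (⟨i, i.2⟩ : Set.Iio n)) fun i j hij =>
    Fin.ext (congrArg Subtype.val hij)

theorem Derivation.apply_mem_of_mem_adjoin (D : Derivation k E E) {L : IntermediateField k E}
    {T : Set E} (hT : T ⊆ L) (h : ∀ t ∈ T, D t ∈ L) {y : E} (hy : y ∈ Algebra.adjoin k T) :
    D y ∈ L := by
  have hle : Algebra.adjoin k T ≤ L.toSubalgebra := Algebra.adjoin_le hT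
  induction hy using Algebra.adjoin_induction with
  | mem x hx => exact h x hx
  | algebraMap r => simp
  | add x y _ _ hx hy => rw [map_add]; exact add_mem hx hy
  | mul x y hx' hy' hx hy =>
    rw [D.leibniz, smul_eq_mul, smul_eq_mul]
    exact add_mem (mul_mem (hle hx') hy) (mul_mem (hle hy') hx)

/-- Differentiating a relation `p(y) = 0` gives `s + p'(y) D y = 0` with `s` in the closure. For `p`
of minimal degree in characteristic zero `p'(y) ≠ 0`, so one can solve for `D y`. -/
theorem Derivation.apply_mem_algClosureAdjoin [CharZero k] (D : Derivation k E E) {T : Set E}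
    (h : ∀ t ∈ T, D t ∈ algClosureAdjoin k T) {y : E} (hy : y ∈ algClosureAdjoin k T) :
    D y ∈ algClosureAdjoin k T := by
  have : CharZero E := charZero_of_injective_algebraMap (algebraMap k E).injective
  set L := algClosureAdjoin k T with hL
  have hsub : ∀ a : Algebra.adjoin k T, (a : E) ∈ L :=
    fun a => Algebra.adjoin_le (S := L.toSubalgebra) (subset_algClosureAdjoin T) a.2
  have hDsub : ∀ a : Algebra.adjoin k T, D a ∈ L :=
    fun a => D.apply_mem_of_mem_adjoin (subset_algClosureAdjoin T) h a.2
  have halg : IsAlgebraic (Algebra.adjoin k T) y :=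
    mem_algClosureAdjoin_iff.1 hy
  obtain ⟨p, ⟨hp0, hpy⟩, hmin⟩ := WellFounded.has_min
    (InvImage.wf (fun p : Polynomial (Algebra.adjoin k T) => p.natDegree) wellFounded_lt)
    {p | p ≠ 0 ∧ Polynomial.aeval y p = 0} halg
  -- The term `s` collects the derivatives of the coefficients of `r`.
  have hD : ∀ r : Polynomial (Algebra.adjoin k T), ∃ s ∈ L,
      D (Polynomial.aeval y r) = s + Polynomial.aeval y (Polynomial.derivative r) * D y := by
    intro r
    induction r using Polynomial.induction_on' with
    | add p q hp hq =>
      obtain ⟨s, hs, hs'⟩ := hp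
      obtain ⟨t, ht, ht'⟩ := hq
      refine ⟨s + t, add_mem hs ht, ?_⟩
      rw [map_add, map_add, hs', ht', Polynomial.derivative_add, map_add]
      ring
    | monomial n a =>
      refine ⟨y ^ n * D a, mul_mem (pow_mem hy n) (hDsub a), ?_⟩
      rw [Polynomial.aeval_monomial, D.leibniz, D.leibniz_pow, Polynomial.derivative_monomial,
        Polynomial.aeval_monomial]
      simp only [smul_eq_mul, nsmul_eq_mul, map_mul]
      change (a : E) * (n * (y ^ (n - 1) * D y)) + y ^ n * D a
        = y ^ n * D a + (a : E) * n * y ^ (n - 1) * D y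
      ring
  have hp' : Polynomial.aeval y (Polynomial.derivative p) ≠ 0 := by
    intro h0
    have hdeg : p.natDegree ≠ 0 := by
      intro hd
      rw [Polynomial.eq_C_of_natDegree_eq_zero hd, Polynomial.aeval_C] at hpy
      apply hp0
      rw [Polynomial.eq_C_of_natDegree_eq_zero hd,
        Subtype.val_injective (a₁ := p.coeff 0) (a₂ := 0) hpy, Polynomial.C_0]
    refine hmin (Polynomial.derivative p) ⟨?_, h0⟩ (Polynomial.natDegree_derivative_lt hdeg)
    intro h1
    exact hdeg (Polynomial.derivative_eq_zero.1 h1)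
  have haev : ∀ r : Polynomial (Algebra.adjoin k T), Polynomial.aeval y r ∈ L := by
    intro r
    rw [Polynomial.aeval_eq_sum_range]
    exact sum_mem fun i _ => by
      rw [Algebra.smul_def]
      exact mul_mem (hsub _) (pow_mem hy i)
  obtain ⟨s, hs, hs'⟩ := hD p
  rw [hpy, map_zero] at hs'
  rw [show D y = -s / Polynomial.aeval y (Polynomial.derivative p) by
    rw [eq_div_iff hp']; linear_combination -hs']
  exact div_mem (neg_mem hs) (haev _)

end RelativeAlgebraicClosure

/-! ### Difference systems `τ(y) = y + b`: from algebraic to linear relations. -/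

section AffineDifferenceSystem

open MvPolynomial

variable {K ι : Type*} [Field K]

/-- The ring endomorphism of `K[Y]` that acts on the coefficients by `σ` and maps `Y i` to
`Y i + b i`. -/
noncomputable def affineShift (σ : K →+* K) (b : ι → K) : MvPolynomial ι K →+* MvPolynomial ι K :=
  eval₂Hom (C.comp σ) fun i => X i + C (b i)

@[simp]
theorem affineShift_C (σ : K →+* K) (b : ι → K) (r : K) : affineShift σ b (C r) = C (σ r) := by
  simp [affineShift]

@[simp]
theorem affineShift_X (σ : K →+* K) (b : ι → K) (i : ι) :
    affineShift σ b (X i) = X i + C (b i) := by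
  simp [affineShift]

/-- Translations commute with partial derivatives, so partial derivatives of an invariant polynomial
are again invariant. -/
theorem pderiv_affineShift (σ : K →+* K) (b : ι → K) (i : ι) (p : MvPolynomial ι K) :
    pderiv i (affineShift σ b p) = affineShift σ b (pderiv i p) := by
  classical
  induction p using MvPolynomial.induction_on with
  | C a => simp
  | add p q hp hq => simp [hp, hq]
  | mul_X p j hp =>
    simp only [map_mul, affineShift_X, pderiv_mul, hp, map_add, pderiv_X, pderiv_C]
    by_cases h : i = j
    · subst h; simp
    · simp [Pi.single_eq_of_ne' h]

theorem coeff_affineShift_monomial [DecidableEq ι] (m : MonomialOrder ι) (σ : K →+* K) (b : ι → K)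
    (d e : ι →₀ ℕ) (c : K) (hde : m.toSyn d ≤ m.toSyn e) :
    coeff e (affineShift σ b (monomial d c)) = if d = e then σ c else 0 := by
  have hmon : ∀ i ∈ d.support, m.Monic ((X i + C (b i)) ^ d i : MvPolynomial ι K) :=
    fun i _ => (m.monic_X_add_C i (b i)).pow
  have hP : m.Monic (∏ i ∈ d.support, (X i + C (b i)) ^ d i : MvPolynomial ι K) :=
    MonomialOrder.Monic.prod hmon
  have hdeg : m.degree (∏ i ∈ d.support, (X i + C (b i)) ^ d i : MvPolynomial ι K) = d := by
    rw [m.degree_prod fun i hi => (hmon i hi).ne_zero]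
    simp_rw [m.degree_pow, m.degree_X_add_C, Finsupp.smul_single, smul_eq_mul, mul_one]
    exact Finsupp.sum_single d
  have hform : affineShift σ b (monomial d c)
      = C (σ c) * ∏ i ∈ d.support, (X i + C (b i)) ^ d i := by
    rw [affineShift, coe_eval₂Hom, eval₂_monomial]
    rfl
  rw [hform, coeff_C_mul]
  split_ifs with h
  · subst h
    have := hP.coeff_degree
    rw [hdeg] at this
    rw [this, mul_one]
  · rw [m.coeff_eq_zero_of_lt, mul_zero]
    rw [hdeg]
    exact lt_of_le_of_ne hde fun h' => h (m.toSyn.injective h')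

/-- Translating the variables creates only monomials below those already present, so at and above
the degree of `p` only `σ` is felt. -/
theorem coeff_affineShift (m : MonomialOrder ι) (σ : K →+* K) (b : ι → K) (p : MvPolynomial ι K)
    (e : ι →₀ ℕ) (he : m.toSyn (m.degree p) ≤ m.toSyn e) :
    coeff e (affineShift σ b p) = σ (coeff e p) := by
  classical
  conv_lhs => rw [p.as_sum, map_sum, coeff_sum]
  rw [Finset.sum_congr rfl fun d hd =>
    coeff_affineShift_monomial m σ b d e _ ((m.le_degree hd).trans he)]
  rw [Finset.sum_ite_eq']
  split_ifs with h
  · rfl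
  · rw [notMem_support_iff.1 h, map_zero]

/-- Take a monic element of least degree in `I`. Since `σ 1 = 1`, the shift preserves its leading
term; the difference lies in `I` with smaller degree and must vanish. -/
theorem exists_affineShift_eq_self (m : MonomialOrder ι) (σ : K →+* K) (b : ι → K)
    (I : Ideal (MvPolynomial ι K)) (hI : I ≠ ⊥) (hσ : ∀ p ∈ I, affineShift σ b p ∈ I) :
    ∃ p ∈ I, p ≠ 0 ∧ affineShift σ b p = p := by
  obtain ⟨p₁, ⟨hp₁, hp₁0⟩, hmin⟩ := WellFounded.has_min
    (InvImage.wf (fun p : MvPolynomial ι K => m.toSyn (m.degree p)) wellFounded_lt)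
    {p | p ∈ I ∧ p ≠ 0} (Submodule.exists_mem_ne_zero_of_ne_bot hI)
  have hlc : m.leadingCoeff p₁ ≠ 0 := m.leadingCoeff_ne_zero_iff.2 hp₁0
  set p := C (m.leadingCoeff p₁)⁻¹ * p₁ with hp
  have hpI : p ∈ I := I.mul_mem_left _ hp₁
  have hp0 : p ≠ 0 := mul_ne_zero (C_ne_zero.2 (inv_ne_zero hlc)) hp₁0
  have hdeg : m.degree p = m.degree p₁ := by
    rw [hp, m.degree_mul (C_ne_zero.2 (inv_ne_zero hlc)) hp₁0, m.degree_C, zero_add]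
  have hcoeff : coeff (m.degree p) p = 1 := by
    rw [hdeg, hp, coeff_C_mul]
    exact inv_mul_cancel₀ hlc
  refine ⟨p, hpI, hp0, ?_⟩
  by_contra hne
  have hd0 : affineShift σ b p - p ≠ 0 := sub_ne_zero.2 hne
  refine hmin (affineShift σ b p - p) ⟨I.sub_mem (hσ p hpI) hpI, hd0⟩ ?_
  change m.toSyn (m.degree (affineShift σ b p - p)) < m.toSyn (m.degree p₁)
  rw [← hdeg]
  by_contra hle
  rw [not_lt] at hle
  apply m.coeff_degree_ne_zero_iff.2 hd0
  rw [coeff_sub, coeff_affineShift m σ b p _ hle, sub_eq_zero]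
  rcases hle.eq_or_lt with h | h
  · rw [← m.toSyn.injective h, hcoeff, map_one]
  · rw [m.coeff_eq_zero_of_lt h, map_zero]

theorem eq_C_of_forall_pderiv_eq_zero [CharZero K] {p : MvPolynomial ι K}
    (h : ∀ i, pderiv i p = 0) : p = C (coeff 0 p) := by
  classical
  ext d
  rw [coeff_C]
  split_ifs with hd
  · rw [hd]
  · obtain ⟨i, hi⟩ : ∃ i, d i ≠ 0 := by
      by_contra! hcon
      exact hd (Finsupp.ext hcon).symm
    have h1 := coeff_pderiv (i := i) p (d - Finsupp.single i 1)
    rw [h i, coeff_zero, tsub_add_cancel_of_le] at h1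
    · rcases mul_eq_zero.1 h1.symm with h2 | h2
      · exact h2
      · exact absurd h2 (Nat.cast_add_one_ne_zero _)
    · rw [Finsupp.single_le_iff]
      omega

/-- A nonconstant invariant of least total degree has constant partial derivatives, since these are
invariants of smaller degree. It is thus affine, `∑ cᵢ Yᵢ + e`, and its invariance is the asserted
relation with `h = -e`. -/
theorem exists_linear_of_affineShift_eq_self [Fintype ι] [CharZero K] (σ : K →+* K) (b : ι → K)
    {p : MvPolynomial ι K} (hp : ∀ r, p ≠ C r) (hσ : affineShift σ b p = p) :
    ∃ c : ι → K, (∃ i, c i ≠ 0) ∧ (∀ i, σ (c i) = c i) ∧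
      ∃ h : K, ∑ i, c i * b i = σ h - h := by
  classical
  obtain ⟨p, ⟨hp, hσ⟩, hmin⟩ := WellFounded.has_min
    (InvImage.wf (fun p : MvPolynomial ι K => p.totalDegree) wellFounded_lt)
    {p | (∀ r, p ≠ C r) ∧ affineShift σ b p = p} ⟨p, hp, hσ⟩
  have hc : ∀ i, ∃ c, pderiv i p = C c := by
    intro i
    by_contra! hcon
    refine hmin (pderiv i p) ⟨hcon, by rw [← pderiv_affineShift, hσ]⟩ ?_
    change (pderiv i p).totalDegree < p.totalDegree
    have hne : pderiv i p ≠ 0 := fun h0 => hcon 0 (by rw [h0, C_0])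
    obtain ⟨d, hd, hd'⟩ : ∃ d ∈ (pderiv i p).support,
        (pderiv i p).totalDegree = d.sum fun _ e => e :=
      Finset.exists_mem_eq_sup _ (support_nonempty.2 hne) _
    rw [hd']
    have h1 : d + Finsupp.single i 1 ∈ p.support := by
      rw [mem_support_iff] at hd ⊢
      rw [coeff_pderiv] at hd
      exact left_ne_zero_of_mul hd
    have h2 := le_totalDegree h1
    rw [Finsupp.sum_add_index' (fun _ => rfl) (fun _ _ _ => rfl),
      Finsupp.sum_single_index rfl] at h2
    omega
  choose c hc using hc
  have hσc : ∀ i, σ (c i) = c i := by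
    intro i
    apply C_injective ι K
    rw [← affineShift_C σ b, ← hc, ← pderiv_affineShift, hσ]
  have hlin : p - ∑ i, C (c i) * X i = C (coeff 0 (p - ∑ i, C (c i) * X i)) := by
    refine eq_C_of_forall_pderiv_eq_zero fun j => ?_
    rw [map_sub, map_sum, hc]
    simp only [pderiv_C_mul, pderiv_X]
    rw [Finset.sum_eq_single j]
    · simp
    · intro i _ hij
      simp [Pi.single_eq_of_ne hij]
    · simp
  set e := coeff 0 (p - ∑ i, C (c i) * X i) with he
  refine ⟨c, ?_, hσc, -e, ?_⟩
  · by_contra! h0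
    apply hp e
    rw [← hlin]
    simp [h0]
  · have h1 := congrArg (affineShift σ b) hlin
    rw [map_sub, hσ, map_sum, affineShift_C] at h1
    simp only [map_mul, affineShift_C, affineShift_X, hσc, mul_add, Finset.sum_add_distrib] at h1
    apply C_injective ι K
    rw [map_sum]
    simp only [map_mul, map_neg, map_sub]
    linear_combination hlin - h1

/-- A family `y` with `τ (y i) = y i + b i` that is algebraically dependent over a difference
subfield satisfies a linear relation over the constants modulo that subfield. -/
theorem exists_linear_of_not_algebraicIndependent {E : Type*} [Field E] [Algebra K E] [Fintype ι]
    [CharZero K] (σ : K →+* K) (τ : E →+* E) (hστ : ∀ r, algebraMap K E (σ r) = τ (algebraMap K E r))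
    (b : ι → K) (y : ι → E) (hy : ∀ i, τ (y i) = y i + algebraMap K E (b i))
    (hdep : ¬ AlgebraicIndependent K y) :
    ∃ c : ι → K, (∃ i, c i ≠ 0) ∧ (∀ i, σ (c i) = c i) ∧
      ∃ h : K, ∑ i, c i * b i = σ h - h := by
  classical
  -- An arbitrary order on the variables, needed only to have a monomial order.
  have : LinearOrder ι := LinearOrder.lift' _ (Fintype.equivFin ι).injective
  let I : Ideal (MvPolynomial ι K) := RingHom.ker (aeval (R := K) y)
  have hI : I ≠ ⊥ := by
    intro h
    apply hdep
    rw [algebraicIndependent_iff_injective_aeval]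
    exact (RingHom.injective_iff_ker_eq_bot _).2 h
  -- Evaluation at `y` intertwines the shift with `τ`; hence the ideal of relations is stable under
  -- the shift.
  have heval : ∀ p, aeval (R := K) y (affineShift σ b p) = τ (aeval (R := K) y p) := by
    intro p
    induction p using MvPolynomial.induction_on with
    | C a => simp [hστ]
    | add p q hp hq => simp [hp, hq]
    | mul_X p i hp => simp [hp, hy]
  obtain ⟨p, hpI, hp0, hp⟩ := exists_affineShift_eq_self (MonomialOrder.degLex (σ := ι)) σ b I hI
    fun p hp => by
      rw [RingHom.mem_ker] at hp ⊢
      rw [heval, hp, map_zero]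
  refine exists_linear_of_affineShift_eq_self σ b (p := p) ?_ hp
  rintro r rfl
  rw [RingHom.mem_ker, aeval_C] at hpI
  apply hp0
  rw [(map_eq_zero _).1 hpI, C_0]

end AffineDifferenceSystem

/-! ### Orders at points of `ℂ*` and their behaviour under `τ` and `∂`. -/

namespace MeroField

theorem exists_eq_mk (z : MeroField) : ∃ (f : ℂ → ℂ) (hf : MeromorphicOn f {0}ᶜ), z = mk f hf := by
  obtain ⟨⟨f, hf⟩, rfl⟩ := Ideal.Quotient.mk_surjective z
  exact ⟨f, hf, rfl⟩

theorem mk_add {f g : ℂ → ℂ} (hf : MeromorphicOn f {0}ᶜ) (hg : MeromorphicOn g {0}ᶜ) :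
    mk f hf + mk g hg = mk (f + g) (hf.add hg) := rfl

theorem mk_mul {f g : ℂ → ℂ} (hf : MeromorphicOn f {0}ᶜ) (hg : MeromorphicOn g {0}ᶜ) :
    mk f hf * mk g hg = mk (f * g) (hf.mul hg) := rfl

theorem mk_sub {f g : ℂ → ℂ} (hf : MeromorphicOn f {0}ᶜ) (hg : MeromorphicOn g {0}ᶜ) :
    mk f hf - mk g hg = mk (f - g) (hf.sub hg) := rfl

theorem algebraMap_eq_mk (c : ℂ) :
    algebraMap ℂ MeroField c = mk (fun _ => c) (MeromorphicOn.const c) := rfl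

theorem eventually_nhdsNE_of_codiscreteWithin {P : ℂ → Prop}
    (h : ∀ᶠ x in codiscreteWithin ({0}ᶜ : Set ℂ), P x) {p : ℂ} (hp : p ≠ 0) :
    ∀ᶠ x in 𝓝[≠] p, P x := by
  rw [eventually_iff, mem_codiscreteWithin_iff_forall_mem_nhdsNE] at h
  filter_upwards [h p hp, mem_nhdsWithin_of_mem_nhds (isOpen_compl_singleton.mem_nhds hp)]
    with x hx hx0
  rcases hx with hx | hx
  · exact hx
  · exact absurd hx0 hx

/-- The order of `z` at the point `p`, which is meaningful for `p ≠ 0`. -/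
noncomputable def ord (p : ℂ) (z : MeroField) : WithTop ℤ :=
  meromorphicOrderAt (exists_eq_mk z).choose p

theorem ord_mk {p : ℂ} (hp : p ≠ 0) {f : ℂ → ℂ} (hf : MeromorphicOn f {0}ᶜ) :
    ord p (mk f hf) = meromorphicOrderAt f p := by
  obtain ⟨hg, h⟩ := (exists_eq_mk (mk f hf)).choose_spec
  exact meromorphicOrderAt_congr (eventually_nhdsNE_of_codiscreteWithin
    ((mk_eq_mk hg hf).1 h.symm) hp)

theorem ord_mul {p : ℂ} (hp : p ≠ 0) (f g : MeroField) : ord p (f * g) = ord p f + ord p g := by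
  obtain ⟨f, hf, rfl⟩ := exists_eq_mk f
  obtain ⟨g, hg, rfl⟩ := exists_eq_mk g
  rw [mk_mul, ord_mk hp, ord_mk hp, ord_mk hp, meromorphicOrderAt_mul (hf p hp) (hg p hp)]

theorem min_le_ord_add {p : ℂ} (hp : p ≠ 0) (f g : MeroField) :
    min (ord p f) (ord p g) ≤ ord p (f + g) := by
  obtain ⟨f, hf, rfl⟩ := exists_eq_mk f
  obtain ⟨g, hg, rfl⟩ := exists_eq_mk g
  rw [mk_add, ord_mk hp, ord_mk hp, ord_mk hp]
  exact meromorphicOrderAt_add (hf p hp) (hg p hp)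

theorem ord_add_eq_left_of_lt {p : ℂ} (hp : p ≠ 0) {f g : MeroField} (h : ord p f < ord p g) :
    ord p (f + g) = ord p f := by
  obtain ⟨f, hf, rfl⟩ := exists_eq_mk f
  obtain ⟨g, hg, rfl⟩ := exists_eq_mk g
  rw [ord_mk hp, ord_mk hp] at h
  rw [mk_add, ord_mk hp, ord_mk hp]
  exact meromorphicOrderAt_add_eq_left_of_lt (hg p hp) h

theorem ord_algebraMap {p : ℂ} (hp : p ≠ 0) {c : ℂ} (hc : c ≠ 0) :
    ord p (algebraMap ℂ MeroField c) = 0 := by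
  classical
  rw [algebraMap_eq_mk, ord_mk hp, meromorphicOrderAt_const, if_neg hc]

theorem ord_one {p : ℂ} (hp : p ≠ 0) : ord p 1 = 0 := by
  rw [← map_one (algebraMap ℂ MeroField), ord_algebraMap hp one_ne_zero]

theorem ord_zero {p : ℂ} (hp : p ≠ 0) : ord p 0 = ⊤ := by
  classical
  rw [← map_zero (algebraMap ℂ MeroField), algebraMap_eq_mk, ord_mk hp,
    meromorphicOrderAt_const, if_pos rfl]

theorem ord_algebraMap_nonneg {p : ℂ} (hp : p ≠ 0) (c : ℂ) :
    0 ≤ ord p (algebraMap ℂ MeroField c) := by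
  rcases eq_or_ne c 0 with rfl | hc
  · rw [map_zero, ord_zero hp]; exact le_top
  · rw [ord_algebraMap hp hc]

theorem ord_ne_top {p : ℂ} (hp : p ≠ 0) {f : MeroField} (hf : f ≠ 0) : ord p f ≠ ⊤ := by
  intro h
  have h1 := ord_mul hp f f⁻¹
  rw [mul_inv_cancel₀ hf, ord_one hp, h, WithTop.top_add] at h1
  exact WithTop.zero_ne_top h1

theorem exists_ord_eq {p : ℂ} (hp : p ≠ 0) {f : MeroField} (hf : f ≠ 0) :
    ∃ n : ℤ, ord p f = n :=
  ⟨_, (WithTop.coe_untop _ (ord_ne_top hp hf)).symm⟩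

theorem ord_div {p : ℂ} (hp : p ≠ 0) {f g : MeroField} {m n : ℤ} (hf : ord p f = m)
    (hg : ord p g = n) : ord p (f / g) = (m - n : ℤ) := by
  have hg0 : g ≠ 0 := by
    rintro rfl
    rw [ord_zero hp] at hg
    exact WithTop.top_ne_coe hg
  have hf0 : f ≠ 0 := by
    rintro rfl
    rw [ord_zero hp] at hf
    exact WithTop.top_ne_coe hf
  obtain ⟨k, hk⟩ := exists_ord_eq hp (div_ne_zero hf0 hg0)
  have h := ord_mul hp (f / g) g
  rw [div_mul_cancel₀ _ hg0, hf, hk, hg, ← WithTop.coe_add, WithTop.coe_inj] at h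
  rw [hk, WithTop.coe_inj]
  omega

theorem ord_neg {p : ℂ} (hp : p ≠ 0) (f : MeroField) : ord p (-f) = ord p f := by
  obtain ⟨f, hf, rfl⟩ := exists_eq_mk f
  change ord p (mk (-f) hf.neg) = _
  rw [ord_mk hp, ord_mk hp, ← meromorphicOrderAt_neg]

theorem ord_X {p : ℂ} (hp : p ≠ 0) : ord p X = 0 := by
  rw [X, ord_mk hp, AnalyticAt.meromorphicOrderAt_eq analyticAt_id,
    analyticAt_id.analyticOrderAt_eq_zero.2 hp]
  rfl

theorem ord_X_sub {p : ℂ} (hp : p ≠ 0) (α : ℂ) :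
    ord p (X - algebraMap ℂ MeroField α) = if p = α then 1 else 0 := by
  have han : AnalyticAt ℂ (fun x : ℂ => x - α) p := by fun_prop
  rw [X, algebraMap_eq_mk, mk_sub, ord_mk hp]
  change meromorphicOrderAt (fun x : ℂ => x - α) p = _
  split_ifs with h
  · subst h
    rw [show (1 : WithTop ℤ) = ((1 : ℤ) : WithTop ℤ) from rfl,
      meromorphicOrderAt_eq_int_iff han.meromorphicAt]
    exact ⟨fun _ => 1, analyticAt_const, one_ne_zero, Eventually.of_forall fun x => by simp⟩
  · rw [han.meromorphicOrderAt_eq, han.analyticOrderAt_eq_zero.2 (sub_ne_zero.2 h)]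
    rfl

theorem ord_qShift (q : ℂˣ) {p : ℂ} (hp : p ≠ 0) (f : MeroField) :
    ord p (qShift q f) = ord (q * p) f := by
  obtain ⟨f, hf, rfl⟩ := exists_eq_mk f
  rw [qShift_mk, ord_mk hp, ord_mk (mul_ne_zero q.ne_zero hp)]
  exact meromorphicOrderAt_comp_of_deriv_ne_zero (g := fun x : ℂ => (q : ℂ) * x) (by fun_prop)
    (by simp)

theorem euler_qShift (q : ℂˣ) (f : MeroField) : euler (qShift q f) = qShift q (euler f) := by
  obtain ⟨f, hf, rfl⟩ := exists_eq_mk f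
  rw [qShift_mk, euler_mk, euler_mk, qShift_mk]
  congr 1
  ext x
  rw [deriv_comp_mul_left, smul_eq_mul]
  ring

theorem iterate_euler_qShift (q : ℂˣ) (n : ℕ) (f : MeroField) :
    euler^[n] (qShift q f) = qShift q (euler^[n] f) :=
  (Function.Commute.iterate_left (f := euler) (g := qShift q) (euler_qShift q) n).eq f

theorem qShift_X (q : ℂˣ) : qShift q X = algebraMap ℂ MeroField q * X := rfl

theorem euler_X : euler X = X := by
  rw [X, euler_mk]
  congr 1
  ext x
  simp

theorem X_ne_zero : X ≠ 0 := by
  intro h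
  have := ord_X (p := 1) one_ne_zero
  rw [h, ord_zero one_ne_zero] at this
  exact WithTop.top_ne_zero this

theorem mk_inv {f : ℂ → ℂ} (hf : MeromorphicOn f {0}ᶜ) : (mk f hf)⁻¹ = mk f⁻¹ hf.inv := by
  by_cases h0 : mk f hf = 0
  · rw [h0, inv_zero]
    have h1 : mk f hf = mk (fun _ => 0) (MeromorphicOn.const 0) := h0
    symm
    refine (mk_eq_mk hf.inv (MeromorphicOn.const 0)).2 ?_
    filter_upwards [(mk_eq_mk _ _).1 h1] with x hx
    simp [hx]
  · refine inv_eq_of_mul_eq_one_right ?_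
    rw [mk_mul]
    refine (mk_eq_mk _ (MeromorphicOn.const 1)).2 ?_
    have hne : ∀ x ∈ ({0}ᶜ : Set ℂ), meromorphicOrderAt f x ≠ ⊤ := fun x hx => by
      rw [← ord_mk hx hf]
      exact ord_ne_top hx h0
    filter_upwards [hf.eventually_codiscreteWithin_apply_ne_zero hne] with x hx
    exact mul_inv_cancel₀ hx

theorem meromorphicOn_logDeriv {f : ℂ → ℂ} (hf : MeromorphicOn f {0}ᶜ) :
    MeromorphicOn (logDeriv f) {0}ᶜ :=
  hf.deriv.div hf

theorem euler_div_self_mk {f : ℂ → ℂ} (hf : MeromorphicOn f {0}ᶜ) :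
    euler (mk f hf) / mk f hf = X * mk (logDeriv f) (meromorphicOn_logDeriv hf) := by
  rw [div_eq_mul_inv, mk_inv, euler_mk, X, mk_mul, mk_mul]
  congr 1
  ext x
  simp only [Pi.mul_apply, Pi.inv_apply, logDeriv, Pi.div_apply, id]
  ring

theorem ord_euler_div_self {p : ℂ} (hp : p ≠ 0) {f : MeroField} (hf0 : f ≠ 0) (h : ord p f ≠ 0) :
    ord p (euler f / f) = (-1 : ℤ) := by
  have htop := ord_ne_top hp hf0
  obtain ⟨f, hf, rfl⟩ := exists_eq_mk f
  rw [ord_mk hp] at h htop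
  rw [euler_div_self_mk, ord_mul hp, ord_X hp, zero_add, ord_mk hp,
    meromorphicOrderAt_logDeriv_eq_neg_one (hf p hp) h htop]
  rfl

theorem ord_euler_div_self_nonneg {p : ℂ} (hp : p ≠ 0) {f : MeroField} (h : ord p f = 0) :
    0 ≤ ord p (euler f / f) := by
  obtain ⟨f, hf, rfl⟩ := exists_eq_mk f
  rw [ord_mk hp] at h
  rw [euler_div_self_mk, ord_mul hp, ord_X hp, zero_add, ord_mk hp]
  exact meromorphicOrderAt_logDeriv_nonneg (hf p hp) h

/-- Off order zero, `∂f/f` has a simple pole, so `∂f = f · (∂f/f)` loses exactly one order. -/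
theorem ord_euler_of_ne_zero {p : ℂ} (hp : p ≠ 0) {f : MeroField} {n : ℤ} (hn : n ≠ 0)
    (h : ord p f = n) : ord p (euler f) = (n - 1 : ℤ) := by
  have hf : f ≠ 0 := by
    rintro rfl
    rw [ord_zero hp] at h
    exact WithTop.top_ne_coe h
  have h1 : ord p f ≠ 0 := by
    rw [h]
    exact_mod_cast hn
  rw [← mul_div_cancel₀ (euler f) hf, ord_mul hp, h, ord_euler_div_self hp hf h1]
  rfl

theorem ord_euler_nonneg {p : ℂ} (hp : p ≠ 0) {f : MeroField} (h : 0 ≤ ord p f) :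
    0 ≤ ord p (euler f) := by
  rcases eq_or_ne f 0 with rfl | hf
  · rw [map_zero, ord_zero hp]; exact le_top
  obtain ⟨n, hn⟩ := exists_ord_eq hp hf
  rcases eq_or_ne n 0 with rfl | hn0
  · rw [← mul_div_cancel₀ (euler f) hf, ord_mul hp]
    exact add_nonneg h (ord_euler_div_self_nonneg hp hn)
  · rw [ord_euler_of_ne_zero hp hn0 hn]
    rw [hn] at h
    have : 0 ≤ n := by exact_mod_cast h
    have : 0 ≤ n - 1 := by omega
    exact_mod_cast this

theorem exists_ord_sub_algebraMap_pos {p : ℂ} (hp : p ≠ 0) {f : MeroField} (h : 0 ≤ ord p f) :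
    ∃ c : ℂ, 0 < ord p (f - algebraMap ℂ MeroField c) := by
  obtain ⟨f, hf, rfl⟩ := exists_eq_mk f
  rw [ord_mk hp] at h
  obtain ⟨c, hc⟩ := tendsto_nhds_of_meromorphicOrderAt_nonneg (hf p hp) h
  refine ⟨c, ?_⟩
  rw [algebraMap_eq_mk, mk_sub, ord_mk hp]
  refine (tendsto_zero_iff_meromorphicOrderAt_pos
    ((hf p hp).sub (MeromorphicAt.const c p))).1 ?_
  have := hc.sub_const c
  rwa [sub_self] at this

/-! ### Elliptic functions: Liouville's theorem and transcendence degree. -/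

theorem mem_ellipticField {q : ℂˣ} {f : MeroField} : f ∈ ellipticField q ↔ qShift q f = f :=
  Iff.rfl

theorem algebraMap_mem_ellipticField (q : ℂˣ) (c : ℂ) :
    algebraMap ℂ MeroField c ∈ ellipticField q :=
  mem_ellipticField.2 ((qShift q).commutes c)

theorem euler_mem_ellipticField {q : ℂˣ} {f : MeroField} (hf : f ∈ ellipticField q) :
    euler f ∈ ellipticField q := by
  rw [mem_ellipticField] at hf ⊢
  rw [← euler_qShift, hf]

theorem ord_zpow_mul_of_mem_ellipticField {q : ℂˣ} {f : MeroField} (hf : f ∈ ellipticField q)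
    {p : ℂ} (hp : p ≠ 0) (n : ℤ) : ord ((q : ℂ) ^ n * p) f = ord p f := by
  have hq : ∀ {p : ℂ}, p ≠ 0 → ord ((q : ℂ) * p) f = ord p f := fun hp => by
    rw [← ord_qShift q hp, mem_ellipticField.1 hf]
  induction n with
  | zero => simp
  | succ n ih =>
    rw [zpow_add_one₀ q.ne_zero, mul_comm _ (q : ℂ), mul_assoc,
      hq (mul_ne_zero (zpow_ne_zero _ q.ne_zero) hp), ih]
  | pred n ih =>
    rw [← ih, ← hq (mul_ne_zero (zpow_ne_zero _ q.ne_zero) hp), ← mul_assoc, ← zpow_one_add₀ q.ne_zero]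
    congr 3
    ring

theorem exists_zpow_mul_mem_annulus {q : ℂˣ} (hq : 1 < ‖(q : ℂ)‖) {x : ℂ} (hx : x ≠ 0) :
    ∃ n : ℤ, 1 ≤ ‖(q : ℂ) ^ n * x‖ ∧ ‖(q : ℂ) ^ n * x‖ ≤ ‖(q : ℂ)‖ := by
  obtain ⟨n, hn1, hn2⟩ := exists_mem_Ico_zpow (norm_pos_iff.2 hx) hq
  have h0 : 0 < ‖(q : ℂ)‖ := zero_lt_one.trans hq
  refine ⟨-n, ?_, ?_⟩
  · rw [norm_mul, norm_zpow, zpow_neg, ← div_eq_inv_mul, one_le_div (zpow_pos h0 n)]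
    exact hn1
  · rw [norm_mul, norm_zpow, zpow_neg, ← div_eq_inv_mul, div_le_iff₀ (zpow_pos h0 n)]
    rw [zpow_add_one₀ h0.ne', mul_comm] at hn2
    exact hn2.le

/-- The fundamental annulus of the multiplication by `q`. -/
def annulus (q : ℂˣ) : Set ℂ := {x | 1 ≤ ‖x‖ ∧ ‖x‖ ≤ ‖(q : ℂ)‖}

theorem isCompact_annulus (q : ℂˣ) : IsCompact (annulus q) := by
  refine (isCompact_closedBall (0 : ℂ) ‖(q : ℂ)‖).of_isClosed_subset ?_ ?_
  · exact (isClosed_le continuous_const continuous_norm).inter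
      (isClosed_le continuous_norm continuous_const)
  · intro x hx
    rw [mem_closedBall_zero_iff]
    exact hx.2

theorem ne_zero_of_mem_annulus {q : ℂˣ} {x : ℂ} (hx : x ∈ annulus q) : x ≠ 0 := by
  rintro rfl
  have := hx.1
  rw [norm_zero] at this
  exact absurd this (by norm_num)

/-- An elliptic function without poles is constant. -/
theorem exists_eq_algebraMap_of_mem_ellipticField {q : ℂˣ} (hq : 1 < ‖(q : ℂ)‖) {f : MeroField}
    (hf : f ∈ ellipticField q) (h : ∀ p ∈ annulus q, 0 ≤ ord p f) :
    ∃ c : ℂ, f = algebraMap ℂ MeroField c := by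
  have hord : ∀ p : ℂ, p ≠ 0 → 0 ≤ ord p f := by
    intro p hp
    obtain ⟨n, hn⟩ := exists_zpow_mul_mem_annulus hq hp
    rw [← ord_zpow_mul_of_mem_ellipticField hf hp n]
    exact h _ hn
  rw [mem_ellipticField] at hf
  obtain ⟨g₀, hg₀, rfl⟩ := exists_eq_mk f
  -- The normal form has the correct value at every point, so nonnegative order means analyticity
  -- and the functional equation will hold pointwise.
  set g := toMeromorphicNFOn g₀ {0}ᶜ with hg
  have hgNF : MeromorphicNFOn g {0}ᶜ := meromorphicNFOn_toMeromorphicNFOn g₀ {0}ᶜ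
  have hmk : mk g₀ hg₀ = mk g hgNF.meromorphicOn :=
    (mk_eq_mk _ _).2 (toMeromorphicNFOn_eqOn_codiscrete hg₀)
  have han : ∀ p : ℂ, p ≠ 0 → AnalyticAt ℂ g p := by
    intro p hp
    rw [← (hgNF hp).meromorphicOrderAt_nonneg_iff_analyticAt, ← ord_mk hp hgNF.meromorphicOn,
      ← hmk]
    exact hord p hp
  rw [hmk, qShift_mk, mk_eq_mk] at hf
  have hper : ∀ p : ℂ, p ≠ 0 → g (q * p) = g p := by
    intro p hp
    have hqp := mul_ne_zero q.ne_zero hp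
    have h1 : ContinuousAt (fun x : ℂ => g (q * x)) p :=
      ContinuousAt.comp (f := fun x : ℂ => (q : ℂ) * x) (han _ hqp).continuousAt (by fun_prop)
    have h2 := eventually_nhdsNE_of_codiscreteWithin hf hp
    have h3 : Tendsto (fun x : ℂ => g (q * x)) (𝓝[≠] p) (𝓝 (g p)) :=
      ((han p hp).continuousAt.tendsto.mono_left nhdsWithin_le_nhds).congr' (h2.mono fun _ h => h.symm)
    exact tendsto_nhds_unique (h1.tendsto.mono_left nhdsWithin_le_nhds) h3
  have hperz : ∀ (n : ℤ) (p : ℂ), p ≠ 0 → g ((q : ℂ) ^ n * p) = g p := by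
    intro n p hp
    induction n with
    | zero => simp
    | succ n ih =>
      rw [zpow_add_one₀ q.ne_zero, mul_comm _ (q : ℂ), mul_assoc,
        hper _ (mul_ne_zero (zpow_ne_zero _ q.ne_zero) hp), ih]
    | pred n ih =>
      rw [← ih, ← hper _ (mul_ne_zero (zpow_ne_zero _ q.ne_zero) hp), ← mul_assoc,
        ← zpow_one_add₀ q.ne_zero]
      congr 3
      ring
  -- Pulling back along `exp` gives an entire function, bounded because `g` takes all its values on
  -- the compact annulus; Liouville applies.
  have hdiff : Differentiable ℂ fun t => g (Complex.exp t) := fun t =>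
    (han _ (Complex.exp_ne_zero t)).differentiableAt.comp t Complex.differentiableAt_exp
  have hbdd : Bornology.IsBounded (Set.range fun t => g (Complex.exp t)) := by
    have hc : ContinuousOn g (annulus q) := fun x hx =>
      (han x (ne_zero_of_mem_annulus hx)).continuousAt.continuousWithinAt
    refine ((isCompact_annulus q).image_of_continuousOn hc).isBounded.subset ?_
    rintro _ ⟨t, rfl⟩
    obtain ⟨n, hn⟩ := exists_zpow_mul_mem_annulus hq (Complex.exp_ne_zero t)
    exact ⟨_, hn, hperz n _ (Complex.exp_ne_zero t)⟩
  obtain ⟨c, hc⟩ := hdiff.exists_const_forall_eq_of_bounded hbdd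
  refine ⟨c, ?_⟩
  rw [hmk, algebraMap_eq_mk, mk_eq_mk]
  filter_upwards [self_mem_codiscreteWithin ({0}ᶜ : Set ℂ)] with x hx
  have := hc (Complex.log x)
  rwa [Complex.exp_log hx] at this

/-- The elliptic functions whose poles in the fundamental annulus are bounded by `s`. -/
noncomputable def ellipticSpace (q : ℂˣ) (s : Multiset ℂ) : Submodule ℂ MeroField where
  carrier := {f | f ∈ ellipticField q ∧ ∀ p ∈ annulus q, ((-(s.count p : ℤ) : ℤ) : WithTop ℤ) ≤ ord p f}
  zero_mem' := ⟨zero_mem _, fun p hp => by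
    rw [ord_zero (ne_zero_of_mem_annulus hp)]; exact le_top⟩
  add_mem' {f g} hf hg := ⟨add_mem hf.1 hg.1, fun p hp =>
    (le_min (hf.2 p hp) (hg.2 p hp)).trans (min_le_ord_add (ne_zero_of_mem_annulus hp) f g)⟩
  smul_mem' c f hf := ⟨by
    rw [Algebra.smul_def]
    exact mul_mem (algebraMap_mem_ellipticField q c) hf.1, fun p hp => by
    rw [Algebra.smul_def, ord_mul (ne_zero_of_mem_annulus hp)]
    exact (hf.2 p hp).trans (le_add_of_nonneg_left
      (ord_algebraMap_nonneg (ne_zero_of_mem_annulus hp) c))⟩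

theorem ellipticSpace_zero_le {q : ℂˣ} (hq : 1 < ‖(q : ℂ)‖) :
    ellipticSpace q 0 ≤ Submodule.span ℂ {(1 : MeroField)} := by
  intro f hf
  obtain ⟨c, rfl⟩ := exists_eq_algebraMap_of_mem_ellipticField hq hf.1 fun p hp => by
    simpa using hf.2 p hp
  rw [Algebra.algebraMap_eq_smul_one]
  exact Submodule.smul_mem _ _ (Submodule.mem_span_singleton_self _)

/-- One more permitted pole raises the dimension by at most one: if `g` attains the new pole order
at `a`, then a suitable multiple of `g` removes the leading term there of any other `f`. -/
theorem exists_ellipticSpace_cons_le (q : ℂˣ) (a : ℂ) (s : Multiset ℂ) :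
    ∃ g, ellipticSpace q (a ::ₘ s) ≤ ellipticSpace q s ⊔ Submodule.span ℂ {g} := by
  by_cases hle : ellipticSpace q (a ::ₘ s) ≤ ellipticSpace q s
  · exact ⟨0, hle.trans le_sup_left⟩
  obtain ⟨g, hg, hgs⟩ := SetLike.not_le_iff_exists.1 hle
  refine ⟨g, fun f hf => ?_⟩
  have hsub : ∀ f ∈ ellipticSpace q (a ::ₘ s), ∀ p ∈ annulus q, p ≠ a →
      ((-(s.count p : ℤ) : ℤ) : WithTop ℤ) ≤ ord p f := by
    intro f hf p hp hpa
    have := hf.2 p hp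
    rwa [Multiset.count_cons_of_ne hpa] at this
  obtain ⟨p, hp, hpg⟩ : ∃ p ∈ annulus q, ¬ ((-(s.count p : ℤ) : ℤ) : WithTop ℤ) ≤ ord p g := by
    by_contra! hcon
    exact hgs ⟨hg.1, hcon⟩
  have hpa : p = a := by
    by_contra hne
    exact hpg (hsub g hg p hp hne)
  subst hpa
  have hp0 := ne_zero_of_mem_annulus hp
  have hg0 : g ≠ 0 := by
    rintro rfl
    exact hgs (zero_mem _)
  obtain ⟨n, hn⟩ := exists_ord_eq hp0 hg0
  have hgn := hg.2 p hp
  rw [hn] at hpg hgn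
  rw [Multiset.count_cons_self] at hgn
  have hn' : n = -(s.count p : ℤ) - 1 := by
    have h1 : ¬ -(s.count p : ℤ) ≤ n := by exact_mod_cast hpg
    have h2 : -((s.count p + 1 : ℕ) : ℤ) ≤ n := by exact_mod_cast hgn
    push_cast at h2
    omega
  have hquot : 0 ≤ ord p (f / g) := by
    rcases eq_or_ne f 0 with rfl | hf0
    · rw [zero_div, ord_zero hp0]; exact le_top
    obtain ⟨m, hm⟩ := exists_ord_eq hp0 hf0
    have hfm := hf.2 p hp
    rw [hm, Multiset.count_cons_self] at hfm
    have h2 : -((s.count p + 1 : ℕ) : ℤ) ≤ m := by exact_mod_cast hfm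
    rw [ord_div hp0 hm hn]
    have h3 : 0 ≤ m - n := by push_cast at h2; omega
    exact_mod_cast h3
  -- `c` is the value of `f / g` at `p`, so `f - c • g` has order at `p` larger than that of `g`.
  obtain ⟨c, hc⟩ := exists_ord_sub_algebraMap_pos hp0 hquot
  have hmem : f - c • g ∈ ellipticSpace q (p ::ₘ s) := sub_mem hf (Submodule.smul_mem _ c hg)
  rw [← sub_add_cancel f (c • g)]
  refine Submodule.add_mem_sup ⟨hmem.1, fun p' hp' => ?_⟩
    (Submodule.smul_mem _ _ (Submodule.mem_span_singleton_self _))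
  by_cases hpp : p' = p
  · subst hpp
    have hfac : f - c • g = g * (f / g - algebraMap ℂ MeroField c) := by
      rw [Algebra.smul_def, mul_sub, mul_div_cancel₀ _ hg0, mul_comm g]
    rw [hfac, ord_mul hp0, hn]
    rcases eq_or_ne (f / g - algebraMap ℂ MeroField c) 0 with h0 | h0
    · rw [h0, ord_zero hp0, WithTop.add_top]
      exact le_top
    · obtain ⟨m, hm⟩ := exists_ord_eq hp0 h0
      rw [hm] at hc ⊢
      have hm1 : 0 < m := by exact_mod_cast hc
      rw [← WithTop.coe_add, WithTop.coe_le_coe]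
      omega
  · exact hsub _ hmem p' hp' hpp

theorem rank_ellipticSpace_le {q : ℂˣ} (hq : 1 < ‖(q : ℂ)‖) (s : Multiset ℂ) :
    Module.rank ℂ (ellipticSpace q s) ≤ (s.card + 1 : ℕ) := by
  have hspan : ∀ g : MeroField, Module.rank ℂ (Submodule.span ℂ {g}) ≤ 1 := fun g =>
    (rank_span_le _).trans (by simp)
  induction s using Multiset.induction_on with
  | empty =>
    refine (Submodule.rank_mono (ellipticSpace_zero_le hq)).trans ((hspan 1).trans ?_)
    simp
  | cons a s ih =>
    obtain ⟨g, hg⟩ := exists_ellipticSpace_cons_le q a s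
    refine (Submodule.rank_mono hg).trans ((Submodule.rank_add_le_rank_add_rank _ _).trans ?_)
    refine (add_le_add ih (hspan g)).trans ?_
    rw [Multiset.card_cons]
    push_cast
    exact le_rfl

theorem exists_mem_ellipticSpace {q : ℂˣ} {f : MeroField} (hf : f ∈ ellipticField q) :
    ∃ s, f ∈ ellipticSpace q s := by
  obtain ⟨g, hg, rfl⟩ := exists_eq_mk f
  have hsub : annulus q ⊆ {0}ᶜ := fun x hx => ne_zero_of_mem_annulus hx
  have hgA : MeromorphicOn g (annulus q) := hg.mono_set hsub
  set D := MeromorphicOn.divisor g (annulus q) with hD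
  have hfin : (Function.support D).Finite := D.finiteSupport (isCompact_annulus q)
  -- Taking absolute values counts zeros as well as poles, which only weakens the bound.
  let d : ℂ →₀ ℕ := Finsupp.ofSupportFinite (fun p => (D p).natAbs)
    (hfin.subset fun p hp => by simpa using hp)
  refine ⟨Finsupp.toMultiset d, hf, fun p hp => ?_⟩
  rw [Finsupp.count_toMultiset, ord_mk (hsub hp)]
  change ((-((D p).natAbs : ℤ) : ℤ) : WithTop ℤ) ≤ _
  rw [hD, MeromorphicOn.divisor_apply hgA hp]
  cases h : meromorphicOrderAt g p with
  | top => exact le_top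
  | coe n =>
    rw [WithTop.untop₀_coe, WithTop.coe_le_coe]
    omega

theorem mul_mem_ellipticSpace {q : ℂˣ} {s t : Multiset ℂ} {f g : MeroField}
    (hf : f ∈ ellipticSpace q s) (hg : g ∈ ellipticSpace q t) : f * g ∈ ellipticSpace q (s + t) := by
  refine ⟨mul_mem hf.1 hg.1, fun p hp => ?_⟩
  rw [ord_mul (ne_zero_of_mem_annulus hp)]
  refine le_trans (le_of_eq ?_) (add_le_add (hf.2 p hp) (hg.2 p hp))
  rw [← WithTop.coe_add, WithTop.coe_inj, Multiset.count_add]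
  push_cast
  ring

theorem ellipticSpace_mono {q : ℂˣ} {s t : Multiset ℂ} (h : s ≤ t) :
    ellipticSpace q s ≤ ellipticSpace q t := fun f hf => ⟨hf.1, fun p hp => by
  refine le_trans ?_ (hf.2 p hp)
  have := Multiset.count_le_of_le p h
  rw [WithTop.coe_le_coe]
  omega⟩

theorem pow_mem_ellipticSpace {q : ℂˣ} {s : Multiset ℂ} {f : MeroField}
    (hf : f ∈ ellipticSpace q s) {i N : ℕ} (hi : i ≤ N) : f ^ i ∈ ellipticSpace q (N • s) := by
  refine ellipticSpace_mono (nsmul_le_nsmul_left zero_le hi) ?_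
  clear hi
  induction i with
  | zero =>
    rw [pow_zero, zero_nsmul]
    refine ⟨one_mem _, fun p hp => ?_⟩
    rw [ord_one (ne_zero_of_mem_annulus hp)]
    simp
  | succ i ih =>
    rw [pow_succ, succ_nsmul]
    exact mul_mem_ellipticSpace ih hf

/-- Two elliptic functions are algebraically dependent over `ℂ`. -/
theorem not_algebraicIndependent_of_mem_ellipticField {q : ℂˣ} (hq : 1 < ‖(q : ℂ)‖)
    {v : Fin 2 → MeroField} (hv : ∀ i, v i ∈ ellipticField q) : ¬ AlgebraicIndependent ℂ v := by
  intro hind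
  obtain ⟨s, hs⟩ := exists_mem_ellipticSpace (hv 0)
  obtain ⟨t, ht⟩ := exists_mem_ellipticSpace (hv 1)
  set d := s.card + t.card with hd
  -- The `(N + 1)²` monomials `v₀ⁱ v₁ʲ` with `i, j ≤ N` lie in a space of dimension at most `N d +
  -- 1`; `N = d + 1` is large enough for a contradiction.
  set N := d + 1 with hN
  have hinj : Function.Injective (MvPolynomial.aeval v : MvPolynomial (Fin 2) ℂ →ₐ[ℂ] MeroField) :=
    algebraicIndependent_iff_injective_aeval.1 hind
  have h1 : LinearIndependent ℂ fun e : Fin 2 →₀ ℕ =>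
      MvPolynomial.aeval v (MvPolynomial.monomial e (1 : ℂ)) := by
    have := (MvPolynomial.basisMonomials (Fin 2) ℂ).linearIndependent.map'
      (MvPolynomial.aeval v : MvPolynomial (Fin 2) ℂ →ₐ[ℂ] MeroField).toLinearMap
      (LinearMap.ker_eq_bot.2 hinj)
    rw [MvPolynomial.coe_basisMonomials] at this
    exact this
  let φ : Fin (N + 1) × Fin (N + 1) → Fin 2 →₀ ℕ := fun ij =>
    Finsupp.single 0 (ij.1 : ℕ) + Finsupp.single 1 (ij.2 : ℕ)
  have hφ : Function.Injective φ := by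
    rintro ⟨i, j⟩ ⟨i', j'⟩ h
    have h0 := DFunLike.congr_fun h 0
    have h1 := DFunLike.congr_fun h 1
    simp [φ] at h0 h1
    ext <;> simp [h0, h1]
  have h2 := h1.comp φ hφ
  have hmem : ∀ ij, ((fun e : Fin 2 →₀ ℕ =>
      MvPolynomial.aeval v (MvPolynomial.monomial e (1 : ℂ))) ∘ φ) ij
        ∈ ellipticSpace q (N • s + N • t) := by
    rintro ⟨i, j⟩
    have : ((fun e : Fin 2 →₀ ℕ =>
      MvPolynomial.aeval v (MvPolynomial.monomial e (1 : ℂ))) ∘ φ) (i, j)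
        = v 0 ^ (i : ℕ) * v 1 ^ (j : ℕ) := by
      simp [φ, MvPolynomial.aeval_monomial, Finsupp.prod_fintype]
    rw [this]
    exact mul_mem_ellipticSpace (pow_mem_ellipticSpace hs (by omega))
      (pow_mem_ellipticSpace ht (by omega))
  have h3 : LinearIndependent ℂ fun ij =>
      (⟨_, hmem ij⟩ : ellipticSpace q (N • s + N • t)) :=
    LinearIndependent.of_comp (Submodule.subtype _) h2
  have h4 := h3.cardinal_le_rank.trans (rank_ellipticSpace_le hq _)
  rw [Cardinal.mk_fintype, Nat.cast_le, Fintype.card_prod, Fintype.card_fin, Multiset.card_add,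
    Multiset.card_nsmul, Multiset.card_nsmul, ← mul_add, ← hd] at h4
  nlinarith

/-- Any elliptic function transcendental over `ℂ` serves as `f`; if there is none, `f = 0` does. -/
theorem exists_ellipticField_subset_algClosureAdjoin {q : ℂˣ} (hq : 1 < ‖(q : ℂ)‖) :
    ∃ f ∈ ellipticField q, ∀ g ∈ ellipticField q,
      g ∈ algClosureAdjoin ℂ ({f} : Set MeroField) := by
  by_cases h : ∃ f ∈ ellipticField q, f ∉ algClosureAdjoin ℂ (∅ : Set MeroField)
  · obtain ⟨f, hf, hf'⟩ := h
    refine ⟨f, hf, fun g hg => ?_⟩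
    let v : ℕ → MeroField := fun i => if i = 0 then f else g
    have hv : ∀ i : Fin 2, v i ∈ ellipticField q := fun i => by
      change (if (i : ℕ) = 0 then f else g) ∈ _
      split_ifs
      · exact hf
      · exact hg
    obtain ⟨j, hj, halg⟩ := exists_isAlgebraic_adjoin_of_not_algebraicIndependent (v := v)
      (not_algebraicIndependent_of_mem_ellipticField hq hv)
    rw [← mem_algClosureAdjoin_iff] at halg
    interval_cases j
    · exact absurd (algClosureAdjoin_le (by simp) halg) hf'
    · refine algClosureAdjoin_le ?_ halg
      rintro _ ⟨i, hi, rfl⟩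
      rw [Set.mem_Iio, Nat.lt_one_iff] at hi
      subst hi
      exact subset_algClosureAdjoin _ rfl
  · push Not at h
    exact ⟨0, zero_mem _, fun g hg => algClosureAdjoin_le (by simp) (h g hg)⟩

/-! ### Rational functions: factorization, divisors and `τ`-invariants. -/

theorem X_mem_ratField : X ∈ ratField := IntermediateField.mem_adjoin_simple_self ℂ X

theorem X_sub_ne_zero (α : ℂ) : X - algebraMap ℂ MeroField α ≠ 0 := by
  intro h
  have h1 := ord_X_sub (p := 1) one_ne_zero α
  rw [h, ord_zero one_ne_zero] at h1
  split_ifs at h1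
  · exact WithTop.top_ne_coe h1
  · exact WithTop.top_ne_zero h1

theorem mem_ratField_iff {f : MeroField} :
    f ∈ ratField ↔ ∃ r s : Polynomial ℂ, f = Polynomial.aeval X r / Polynomial.aeval X s :=
  IntermediateField.mem_adjoin_simple_iff ℂ f

theorem aeval_X_mem_ratField (r : Polynomial ℂ) : Polynomial.aeval X r ∈ ratField :=
  mem_ratField_iff.2 ⟨r, 1, by simp⟩

theorem qShift_mem_ratField (q : ℂˣ) {f : MeroField} (hf : f ∈ ratField) :
    qShift q f ∈ ratField := by
  have h : ratField ≤ ratField.comap (qShift q) := by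
    refine IntermediateField.adjoin_le_iff.2 ?_
    rintro _ rfl
    change qShift q X ∈ ratField
    rw [qShift_X]
    exact mul_mem (algebraMap_mem _ _) X_mem_ratField
  exact h hf

theorem euler_mem_ratField {f : MeroField} (hf : f ∈ ratField) : euler f ∈ ratField := by
  have hpoly : ∀ r : Polynomial ℂ, euler (Polynomial.aeval X r) ∈ ratField := fun r => by
    rw [Derivation.map_aeval, euler_X, smul_eq_mul]
    exact mul_mem (aeval_X_mem_ratField _) X_mem_ratField
  obtain ⟨r, s, rfl⟩ := mem_ratField_iff.1 hf
  rw [Derivation.leibniz_div]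
  simp only [smul_eq_mul]
  exact mul_mem (pow_mem (inv_mem (aeval_X_mem_ratField _)) 2)
    (sub_mem (mul_mem (aeval_X_mem_ratField _) (hpoly _))
      (mul_mem (aeval_X_mem_ratField _) (hpoly _)))

theorem iterate_euler_mem_ratField {f : MeroField} (hf : f ∈ ratField) (n : ℕ) :
    euler^[n] f ∈ ratField := by
  induction n with
  | zero => exact hf
  | succ n ih =>
    rw [Function.iterate_succ_apply']
    exact euler_mem_ratField ih

/-- The product of the powers of `x - α` with exponents `m α`. -/
noncomputable def factorProd (m : ℂ →₀ ℤ) : MeroField :=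
  m.prod fun α n => (X - algebraMap ℂ MeroField α) ^ n

theorem factorProd_add (m m' : ℂ →₀ ℤ) : factorProd (m + m') = factorProd m * factorProd m' := by
  classical
  exact Finsupp.prod_add_index' (fun _ => zpow_zero _) fun α _ _ => zpow_add₀ (X_sub_ne_zero α) _ _

theorem factorProd_single (α : ℂ) (n : ℤ) :
    factorProd (Finsupp.single α n) = (X - algebraMap ℂ MeroField α) ^ n :=
  Finsupp.prod_single_index (zpow_zero _)

theorem factorProd_zero : factorProd 0 = 1 := Finsupp.prod_zero_index

theorem factorProd_neg_mul (m : ℂ →₀ ℤ) : factorProd (-m) * factorProd m = 1 := by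
  rw [← factorProd_add, neg_add_cancel, factorProd_zero]

theorem factorProd_ne_zero (m : ℂ →₀ ℤ) : factorProd m ≠ 0 :=
  right_ne_zero_of_mul_eq_one (factorProd_neg_mul m)

theorem factorProd_neg (m : ℂ →₀ ℤ) : factorProd (-m) = (factorProd m)⁻¹ :=
  eq_inv_of_mul_eq_one_left (factorProd_neg_mul m)

theorem exists_aeval_X_eq_factorProd {r : Polynomial ℂ} (hr : r ≠ 0) :
    ∃ (c : ℂ) (m : ℂ →₀ ℤ), c ≠ 0 ∧
      Polynomial.aeval X r = algebraMap ℂ MeroField c * factorProd m := by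
  have hprod : ∀ s : Multiset ℂ, ∃ m : ℂ →₀ ℤ,
      Polynomial.aeval X (s.map fun a => Polynomial.X - Polynomial.C a).prod = factorProd m := by
    intro s
    induction s using Multiset.induction_on with
    | empty => exact ⟨0, by simp [factorProd_zero]⟩
    | cons a s ih =>
      obtain ⟨m, hm⟩ := ih
      refine ⟨Finsupp.single a 1 + m, ?_⟩
      rw [Multiset.map_cons, Multiset.prod_cons, map_mul, hm, factorProd_add, factorProd_single,
        zpow_one, map_sub, Polynomial.aeval_X, Polynomial.aeval_C]
  obtain ⟨m, hm⟩ := hprod r.roots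
  refine ⟨r.leadingCoeff, m, Polynomial.leadingCoeff_ne_zero.2 hr, ?_⟩
  conv_lhs => rw [(IsAlgClosed.splits r).eq_prod_roots]
  rw [map_mul, Polynomial.aeval_C, hm]

theorem exists_eq_factorProd {f : MeroField} (hf : f ∈ ratField) (hf0 : f ≠ 0) :
    ∃ (c : ℂ) (m : ℂ →₀ ℤ), c ≠ 0 ∧ f = algebraMap ℂ MeroField c * factorProd m := by
  obtain ⟨r, s, rfl⟩ := mem_ratField_iff.1 hf
  obtain ⟨c, m, hc, hm⟩ := exists_aeval_X_eq_factorProd (r := r) (by rintro rfl; simp at hf0)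
  obtain ⟨d, l, hd, hl⟩ := exists_aeval_X_eq_factorProd (r := s) (by rintro rfl; simp at hf0)
  refine ⟨c / d, m + -l, div_ne_zero hc hd, ?_⟩
  rw [hm, hl, factorProd_add, factorProd_neg, map_div₀]
  have h1 : algebraMap ℂ MeroField d ≠ 0 := (map_ne_zero _).2 hd
  have h2 := factorProd_ne_zero l
  field_simp

theorem ord_factorProd {p : ℂ} (hp : p ≠ 0) (m : ℂ →₀ ℤ) : ord p (factorProd m) = m p := by
  classical
  have hzpow : ∀ (α : ℂ) (n : ℤ), ord p ((X - algebraMap ℂ MeroField α) ^ n)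
      = ((if α = p then n else 0 : ℤ) : WithTop ℤ) := by
    intro α n
    have hα : ord p (X - algebraMap ℂ MeroField α) = ((if α = p then 1 else 0 : ℤ) : WithTop ℤ) := by
      rw [ord_X_sub hp]
      by_cases h : p = α <;> simp [h, eq_comm]
    have hnat : ∀ k : ℕ, ord p ((X - algebraMap ℂ MeroField α) ^ k)
        = ((if α = p then (k : ℤ) else 0 : ℤ) : WithTop ℤ) := by
      intro k
      induction k with
      | zero => simp [ord_one hp]
      | succ k ih =>
        rw [pow_succ, ord_mul hp, ih, hα, ← WithTop.coe_add, WithTop.coe_inj]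
        split_ifs <;> simp
    obtain ⟨k, rfl | rfl⟩ := n.eq_nat_or_neg
    · rw [zpow_natCast, hnat]
    · rw [zpow_neg, zpow_natCast, ← one_div, ord_div hp (ord_one hp) (hnat k), WithTop.coe_inj]
      split_ifs <;> simp
  induction m using Finsupp.induction_linear with
  | zero => rw [factorProd_zero, ord_one hp]; rfl
  | add f g hf hg =>
    rw [factorProd_add, ord_mul hp, hf, hg, ← WithTop.coe_add, Finsupp.add_apply]
  | single α n => rw [factorProd_single, hzpow, Finsupp.single_apply]

theorem ord_algebraMap_mul_factorProd {p : ℂ} (hp : p ≠ 0) {c : ℂ} (hc : c ≠ 0) (m : ℂ →₀ ℤ) :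
    ord p (algebraMap ℂ MeroField c * factorProd m) = m p := by
  rw [ord_mul hp, ord_algebraMap hp hc, zero_add, ord_factorProd hp]

theorem finite_setOf_ord_ne_zero {f : MeroField} (hf : f ∈ ratField) (hf0 : f ≠ 0) :
    {p : ℂ | p ≠ 0 ∧ ord p f ≠ 0}.Finite := by
  obtain ⟨c, m, hc, rfl⟩ := exists_eq_factorProd hf hf0
  refine m.support.finite_toSet.subset fun p hp => ?_
  have h := hp.2
  rw [ord_algebraMap_mul_factorProd hp.1 hc] at h
  rw [Finset.mem_coe, Finsupp.mem_support_iff]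
  exact fun h0 => h (by rw [h0]; rfl)

theorem zpow_mul_injective {q : ℂˣ} (hq : 1 < ‖(q : ℂ)‖) {p : ℂ} (hp : p ≠ 0) :
    Function.Injective fun n : ℤ => (q : ℂ) ^ n * p := by
  intro m n h
  have h1 := congrArg norm (mul_right_cancel₀ hp h)
  rw [norm_zpow, norm_zpow] at h1
  exact zpow_right_injective₀ (zero_lt_one.trans hq) hq.ne' h1

theorem finite_setOf_ord_zpow_mul_neg {q : ℂˣ} (hq : 1 < ‖(q : ℂ)‖) {f : MeroField}
    (hf : f ∈ ratField) {p : ℂ} (hp : p ≠ 0) : {n : ℤ | ord ((q : ℂ) ^ n * p) f < 0}.Finite := by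
  rcases eq_or_ne f 0 with rfl | hf0
  · refine Set.finite_empty.subset fun n hn => ?_
    rw [Set.mem_ofPred_eq, ord_zero (mul_ne_zero (zpow_ne_zero _ q.ne_zero) hp)] at hn
    exact not_top_lt hn
  · refine ((finite_setOf_ord_ne_zero hf hf0).preimage
      (zpow_mul_injective hq hp).injOn).subset fun n hn => ?_
    exact ⟨mul_ne_zero (zpow_ne_zero _ q.ne_zero) hp, hn.ne⟩

/-- A pole of an invariant function in `ℂ*` repeats along an infinite `q`-orbit, while a rational
function has finitely many poles. So there is none and Liouville's theorem for elliptic functions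
applies. -/
theorem exists_eq_algebraMap_of_mem_ratField {q : ℂˣ} (hq : 1 < ‖(q : ℂ)‖) {f : MeroField}
    (hf : f ∈ ratField) (hf' : qShift q f = f) : ∃ c : ℂ, f = algebraMap ℂ MeroField c := by
  refine exists_eq_algebraMap_of_mem_ellipticField hq (mem_ellipticField.2 hf') fun p hp => ?_
  have hp0 := ne_zero_of_mem_annulus hp
  by_contra! hlt
  refine Set.infinite_univ ((finite_setOf_ord_zpow_mul_neg hq hf hp0).subset fun n _ => ?_)
  rw [Set.mem_ofPred_eq, ord_zpow_mul_of_mem_ellipticField (mem_ellipticField.2 hf') hp0]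
  exact hlt

/-! ### Differential operators with constant coefficients. -/

theorem euler_algebraMap (c : ℂ) : euler (algebraMap ℂ MeroField c) = 0 :=
  Derivation.map_algebraMap _ c

theorem iterate_euler_add (n : ℕ) (f g : MeroField) :
    euler^[n] (f + g) = euler^[n] f + euler^[n] g := by
  induction n with
  | zero => rfl
  | succ n ih => simp only [Function.iterate_succ_apply', ih, Derivation.map_add]

theorem iterate_euler_sub (n : ℕ) (f g : MeroField) :
    euler^[n] (f - g) = euler^[n] f - euler^[n] g := by
  induction n with
  | zero => rfl
  | succ n ih => simp only [Function.iterate_succ_apply', ih, Derivation.map_sub]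

theorem iterate_euler_zero (n : ℕ) : euler^[n] 0 = 0 :=
  Function.iterate_fixed (Derivation.map_zero euler) n

/-- The linear differential operator `∑ i < n, c i ∂^i` with constant coefficients. -/
noncomputable def constOp (c : ℕ → ℂ) (n : ℕ) (f : MeroField) : MeroField :=
  ∑ i ∈ Finset.range n, algebraMap ℂ MeroField (c i) * euler^[i] f

theorem constOp_add (c : ℕ → ℂ) (n : ℕ) (f g : MeroField) :
    constOp c n (f + g) = constOp c n f + constOp c n g := by
  simp only [constOp, iterate_euler_add, mul_add, Finset.sum_add_distrib]

theorem constOp_sub (c : ℕ → ℂ) (n : ℕ) (f g : MeroField) :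
    constOp c n (f - g) = constOp c n f - constOp c n g := by
  simp only [constOp, iterate_euler_sub, mul_sub, Finset.sum_sub_distrib]

theorem constOp_qShift (c : ℕ → ℂ) (n : ℕ) (q : ℂˣ) (f : MeroField) :
    constOp c n (qShift q f) = qShift q (constOp c n f) := by
  simp only [constOp, map_sum, map_mul, iterate_euler_qShift, AlgHom.commutes]

theorem exists_constOp_algebraMap (c : ℕ → ℂ) (n : ℕ) (e : ℂ) :
    ∃ e' : ℂ, constOp c n (algebraMap ℂ MeroField e) = algebraMap ℂ MeroField e' := by
  have h : ∀ i : ℕ, ∃ e' : ℂ, euler^[i] (algebraMap ℂ MeroField e) = algebraMap ℂ MeroField e' := by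
    intro i
    cases i with
    | zero => exact ⟨e, rfl⟩
    | succ i =>
      refine ⟨0, ?_⟩
      rw [Function.iterate_succ_apply, euler_algebraMap, iterate_euler_zero, RingHom.map_zero]
  induction n with
  | zero => exact ⟨0, by rw [constOp, Finset.sum_range_zero, RingHom.map_zero]⟩
  | succ n ih =>
    obtain ⟨e₁, h₁⟩ := ih
    obtain ⟨e₂, h₂⟩ := h n
    refine ⟨e₁ + c n * e₂, ?_⟩
    rw [constOp, Finset.sum_range_succ, ← constOp, h₁, h₂, RingHom.map_add, RingHom.map_mul]

theorem constOp_mem_ratField (c : ℕ → ℂ) (n : ℕ) {f : MeroField} (hf : f ∈ ratField) :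
    constOp c n f ∈ ratField :=
  sum_mem fun i _ => mul_mem (algebraMap_mem _ _) (iterate_euler_mem_ratField hf i)

theorem ord_add_nonneg {p : ℂ} (hp : p ≠ 0) {f g : MeroField} (hf : 0 ≤ ord p f)
    (hg : 0 ≤ ord p g) : 0 ≤ ord p (f + g) :=
  (le_min hf hg).trans (min_le_ord_add hp f g)

theorem ord_sub_nonneg {p : ℂ} (hp : p ≠ 0) {f g : MeroField} (hf : 0 ≤ ord p f)
    (hg : 0 ≤ ord p g) : 0 ≤ ord p (f - g) := by
  rw [sub_eq_add_neg]
  exact ord_add_nonneg hp hf (by rwa [ord_neg hp])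

theorem ord_constOp_nonneg {p : ℂ} (hp : p ≠ 0) (c : ℕ → ℂ) (n : ℕ) {f : MeroField}
    (hf : 0 ≤ ord p f) : 0 ≤ ord p (constOp c n f) := by
  have hiter : ∀ i : ℕ, 0 ≤ ord p (euler^[i] f) := by
    intro i
    induction i with
    | zero => exact hf
    | succ i ih =>
      rw [Function.iterate_succ_apply']
      exact ord_euler_nonneg hp ih
  induction n with
  | zero =>
    rw [constOp, Finset.sum_range_zero, ord_zero hp]
    exact le_top
  | succ n ih =>
    rw [constOp, Finset.sum_range_succ]
    refine ord_add_nonneg hp ih ?_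
    rw [ord_mul hp]
    exact add_nonneg (ord_algebraMap_nonneg hp _) (hiter n)

theorem ord_iterate_euler {p : ℂ} (hp : p ≠ 0) {f : MeroField} (hf : ord p f = (-1 : ℤ)) (i : ℕ) :
    ord p (euler^[i] f) = (-1 - i : ℤ) := by
  induction i with
  | zero => simpa using hf
  | succ i ih =>
    rw [Function.iterate_succ_apply', ord_euler_of_ne_zero hp (by omega) ih, WithTop.coe_inj]
    push_cast
    ring

/-- At a simple pole `∂ⁱf` has a pole of order `i + 1`. These orders are distinct, so the highest
term with nonzero coefficient cannot be cancelled. -/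
theorem ord_constOp_neg {p : ℂ} (hp : p ≠ 0) (c : ℕ → ℂ) (n : ℕ) {f : MeroField}
    (hf : ord p f = (-1 : ℤ)) (hc : ∃ i < n, c i ≠ 0) : ord p (constOp c n f) < 0 := by
  have hle : ∀ n : ℕ, ((-n : ℤ) : WithTop ℤ) ≤ ord p (constOp c n f) := by
    intro n
    induction n with
    | zero =>
      rw [constOp, Finset.sum_range_zero, ord_zero hp]
      exact le_top
    | succ n ih =>
      rw [constOp, Finset.sum_range_succ]
      refine le_trans (le_min (le_trans ?_ ih) ?_) (min_le_ord_add hp _ _)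
      · rw [WithTop.coe_le_coe]
        push_cast
        omega
      · rw [ord_mul hp, ord_iterate_euler hp hf]
        refine le_trans (le_of_eq ?_) (le_add_of_nonneg_left (ord_algebraMap_nonneg hp (c n)))
        rw [WithTop.coe_inj]
        push_cast
        ring
  induction n with
  | zero => obtain ⟨i, hi, -⟩ := hc; omega
  | succ n ih =>
    rw [constOp, Finset.sum_range_succ]
    by_cases hn : c n = 0
    · rw [hn, map_zero, zero_mul, add_zero]
      obtain ⟨i, hi, hci⟩ := hc
      refine ih ⟨i, lt_of_le_of_ne (by omega) ?_, hci⟩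
      rintro rfl
      exact hci hn
    · have h1 : ord p (algebraMap ℂ MeroField (c n) * euler^[n] f) = (-1 - n : ℤ) := by
        rw [ord_mul hp, ord_algebraMap hp hn, zero_add, ord_iterate_euler hp hf]
      have h2 : ord p (algebraMap ℂ MeroField (c n) * euler^[n] f) < ord p (constOp c n f) := by
        rw [h1]
        refine lt_of_lt_of_le ?_ (hle n)
        rw [WithTop.coe_lt_coe]
        omega
      rw [add_comm, ← constOp, ord_add_eq_left_of_lt hp h2, h1]
      have : (-1 - n : ℤ) < 0 := by omega
      exact_mod_cast this

/-! ### The group of twists. -/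

/-- `a = c xⁿ τ(g)/g` for a nonzero constant `c` and a nonzero rational function `g`. -/
def IsTwist (q : ℂˣ) (a : MeroField) : Prop :=
  ∃ g ∈ ratField, g ≠ 0 ∧ ∃ (n : ℤ) (c : ℂ), c ≠ 0 ∧
    a = algebraMap ℂ MeroField c * X ^ n * (qShift q g / g)

namespace IsTwist

variable {q : ℂˣ} {a b : MeroField}

theorem one : IsTwist q 1 := ⟨1, one_mem _, one_ne_zero, 0, 1, one_ne_zero, by simp⟩

theorem mul (ha : IsTwist q a) (hb : IsTwist q b) : IsTwist q (a * b) := by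
  obtain ⟨g, hg, hg0, n, c, hc, rfl⟩ := ha
  obtain ⟨h, hh, hh0, m, d, hd, rfl⟩ := hb
  refine ⟨g * h, mul_mem hg hh, mul_ne_zero hg0 hh0, n + m, c * d, mul_ne_zero hc hd, ?_⟩
  rw [map_mul, map_mul, zpow_add₀ X_ne_zero]
  field_simp

theorem inv (ha : IsTwist q a) : IsTwist q a⁻¹ := by
  obtain ⟨g, hg, hg0, n, c, hc, rfl⟩ := ha
  refine ⟨g⁻¹, inv_mem hg, inv_ne_zero hg0, -n, c⁻¹, inv_ne_zero hc, ?_⟩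
  rw [map_inv₀, map_inv₀, zpow_neg, mul_inv, mul_inv, inv_div, inv_div_inv]

theorem zpow (ha : IsTwist q a) (n : ℤ) : IsTwist q (a ^ n) := by
  have hpow : ∀ k : ℕ, IsTwist q (a ^ k) := by
    intro k
    induction k with
    | zero => rw [pow_zero]; exact one
    | succ k ih => rw [pow_succ]; exact ih.mul ha
  obtain ⟨k, rfl | rfl⟩ := n.eq_nat_or_neg
  · rw [zpow_natCast]; exact hpow k
  · rw [zpow_neg, zpow_natCast]; exact (hpow k).inv

/-- A zero can be moved along its `q`-orbit. One step is `(x - β)/(x - qβ) = q⁻¹ τ(g)/g` with `g = x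
- qβ`; the general case telescopes. -/
theorem X_sub_zpow_mul_div (q : ℂˣ) (α : ℂ) (j : ℤ) :
    IsTwist q ((X - algebraMap ℂ MeroField ((q : ℂ) ^ j * α)) / (X - algebraMap ℂ MeroField α)) := by
  have hstep : ∀ β : ℂ, IsTwist q
      ((X - algebraMap ℂ MeroField β) / (X - algebraMap ℂ MeroField (q * β))) := by
    intro β
    refine ⟨X - algebraMap ℂ MeroField (q * β), sub_mem X_mem_ratField (algebraMap_mem _ _),
      X_sub_ne_zero _, 0, (q : ℂ)⁻¹, inv_ne_zero q.ne_zero, ?_⟩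
    have hq : algebraMap ℂ MeroField (q : ℂ) ≠ 0 := (map_ne_zero _).2 q.ne_zero
    rw [map_sub, qShift_X, AlgHom.commutes, map_mul, ← mul_sub, map_inv₀, zpow_zero, mul_one,
      mul_div_assoc, inv_mul_cancel_left₀ hq]
  induction j with
  | zero =>
    rw [zpow_zero, one_mul, div_self (X_sub_ne_zero α)]
    exact one
  | succ j ih =>
    have h := ih.mul (hstep ((q : ℂ) ^ (j : ℤ) * α)).inv
    rw [inv_div, mul_comm, div_mul_div_cancel₀ (X_sub_ne_zero _), ← mul_assoc,
      ← zpow_one_add₀ q.ne_zero, add_comm] at h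
    exact h
  | pred j ih =>
    have h := (hstep ((q : ℂ) ^ (-(j : ℤ) - 1) * α)).mul ih
    rw [← mul_assoc, ← zpow_one_add₀ q.ne_zero, add_sub_cancel,
      div_mul_div_cancel₀ (X_sub_ne_zero _)] at h
    exact h

end IsTwist

/-! ### Logarithmic derivatives and the telescoping criterion for twists. -/

/-- The logarithmic derivative. -/
noncomputable def dlog (f : MeroField) : MeroField := euler f / f

theorem dlog_mul {f g : MeroField} (hf : f ≠ 0) (hg : g ≠ 0) : dlog (f * g) = dlog f + dlog g := by
  simp only [dlog, Derivation.leibniz, smul_eq_mul]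
  field_simp
  ring

theorem dlog_inv {f : MeroField} (hf : f ≠ 0) : dlog f⁻¹ = -dlog f := by
  rw [eq_neg_iff_add_eq_zero, ← dlog_mul (inv_ne_zero hf) hf, inv_mul_cancel₀ hf, dlog,
    Derivation.map_one_eq_zero, zero_div]

theorem dlog_div {f g : MeroField} (hf : f ≠ 0) (hg : g ≠ 0) :
    dlog (f / g) = dlog f - dlog g := by
  rw [div_eq_mul_inv, dlog_mul hf (inv_ne_zero hg), dlog_inv hg, sub_eq_add_neg]

theorem dlog_algebraMap (c : ℂ) : dlog (algebraMap ℂ MeroField c) = 0 := by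
  rw [dlog, euler_algebraMap, zero_div]

theorem dlog_X_zpow (n : ℤ) : dlog (X ^ n) = algebraMap ℂ MeroField n := by
  have hpow : ∀ k : ℕ, dlog (X ^ k) = algebraMap ℂ MeroField k := by
    intro k
    induction k with
    | zero => rw [pow_zero, ← map_one (algebraMap ℂ MeroField), dlog_algebraMap, Nat.cast_zero, map_zero]
    | succ k ih =>
      rw [pow_succ, dlog_mul (pow_ne_zero _ X_ne_zero) X_ne_zero, ih, Nat.cast_succ,
        RingHom.map_add, RingHom.map_one]
      congr 1
      rw [dlog, euler_X, div_self X_ne_zero]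
  obtain ⟨k, rfl | rfl⟩ := n.eq_nat_or_neg
  · rw [zpow_natCast, hpow, Int.cast_natCast]
  · rw [zpow_neg, zpow_natCast, dlog_inv (pow_ne_zero _ X_ne_zero), hpow, Int.cast_neg,
      RingHom.map_neg, Int.cast_natCast]

theorem dlog_qShift (q : ℂˣ) (f : MeroField) : dlog (qShift q f) = qShift q (dlog f) := by
  rw [dlog, dlog, euler_qShift, map_div₀]

theorem dlog_mem_ratField {f : MeroField} (hf : f ∈ ratField) : dlog f ∈ ratField :=
  div_mem (euler_mem_ratField hf) hf

theorem qShift_add (q : ℂˣ) (f g : MeroField) : qShift q (f + g) = qShift q f + qShift q g :=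
  RingHom.map_add (qShift q).toRingHom f g

theorem qShift_ne_zero (q : ℂˣ) {f : MeroField} (hf : f ≠ 0) : qShift q f ≠ 0 :=
  (map_ne_zero _).2 hf

/-- Under `dlog` the factor `c` disappears, `xⁿ` leaves `n`, and `τ(g)/g` becomes a difference. The
`n` is why a constant `e` is allowed in `IsTelescoping`. -/
theorem IsTwist.exists_dlog_eq {q : ℂˣ} {a : MeroField} (ha : IsTwist q a) :
    ∃ h ∈ ratField, ∃ e : ℂ, dlog a = qShift q h - h + algebraMap ℂ MeroField e := by
  obtain ⟨g, hg, hg0, n, c, hc, rfl⟩ := ha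
  refine ⟨dlog g, dlog_mem_ratField hg, n, ?_⟩
  have hc' : algebraMap ℂ MeroField c ≠ 0 := (map_ne_zero _).2 hc
  rw [dlog_mul (mul_ne_zero hc' (zpow_ne_zero _ X_ne_zero)) (div_ne_zero (qShift_ne_zero q hg0) hg0),
    dlog_mul hc' (zpow_ne_zero _ X_ne_zero), dlog_algebraMap, dlog_X_zpow,
    dlog_div (qShift_ne_zero q hg0) hg0, dlog_qShift]
  ring

/-- `L(∂a/a) = τ(h) - h + e` for a rational function `h` and a constant `e`, where `L` is the
operator `constOp c n`. -/
def IsTelescoping (q : ℂˣ) (c : ℕ → ℂ) (n : ℕ) (a : MeroField) : Prop :=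
  ∃ h ∈ ratField, ∃ e : ℂ, constOp c n (dlog a) = qShift q h - h + algebraMap ℂ MeroField e

theorem IsTelescoping.mul_of_isTwist {q : ℂˣ} {c : ℕ → ℂ} {n : ℕ} {a b : MeroField}
    (ha : IsTelescoping q c n a) (ha0 : a ≠ 0) (hb : IsTwist q b) (hb0 : b ≠ 0) :
    IsTelescoping q c n (a * b) := by
  obtain ⟨h, hh, e, he⟩ := ha
  obtain ⟨k, hk, d, hd⟩ := hb.exists_dlog_eq
  obtain ⟨d', hd'⟩ := exists_constOp_algebraMap c n d
  refine ⟨h + constOp c n k, add_mem hh (constOp_mem_ratField c n hk), e + d', ?_⟩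
  rw [dlog_mul ha0 hb0, constOp_add, he, hd, constOp_add, constOp_sub, constOp_qShift, hd',
    qShift_add, RingHom.map_add]
  ring

/-- By `hm` each orbit in `ℂ*` meets the support at most once, so `τ(h) - h` has a pole at `α` and
nowhere else on its orbit. The poles of `h` then propagate without end in one direction along the
orbit, which is impossible for a rational function. -/
theorem support_subset_of_isTelescoping {q : ℂˣ} (hq : 1 < ‖(q : ℂ)‖) {c : ℕ → ℂ} {n : ℕ}
    (hc : ∃ i < n, c i ≠ 0) {c₀ : ℂ} (hc₀ : c₀ ≠ 0) {m : ℂ →₀ ℤ}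
    (hm : ∀ α ∈ m.support, α ≠ 0 → ∀ j : ℤ, (q : ℂ) ^ j * α ∈ m.support → j = 0)
    (h : IsTelescoping q c n (algebraMap ℂ MeroField c₀ * factorProd m)) : m.support ⊆ {0} := by
  intro α hα
  rw [Finset.mem_singleton]
  by_contra hα0
  obtain ⟨h, hh, e, he⟩ := h
  set a := algebraMap ℂ MeroField c₀ * factorProd m with ha
  have ha0 : a ≠ 0 := mul_ne_zero ((map_ne_zero _).2 hc₀) (factorProd_ne_zero m)
  have hne : ∀ j : ℤ, (q : ℂ) ^ j * α ≠ 0 := fun j => mul_ne_zero (zpow_ne_zero _ q.ne_zero) hα0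
  set S : Set ℤ := {j : ℤ | ord ((q : ℂ) ^ j * α) h < 0} with hS
  have hSfin : S.Finite := finite_setOf_ord_zpow_mul_neg hq hh hα0
  set r := qShift q h - h with hr
  have hτ : ∀ j : ℤ, ord ((q : ℂ) ^ j * α) (qShift q h) = ord ((q : ℂ) ^ (j + 1) * α) h := by
    intro j
    rw [ord_qShift q (hne j), ← mul_assoc, ← zpow_one_add₀ q.ne_zero, add_comm]
  have hreg : ∀ j : ℤ, j ≠ 0 → 0 ≤ ord ((q : ℂ) ^ j * α) r := by
    intro j hj
    have h0 : ord ((q : ℂ) ^ j * α) a = 0 := by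
      rw [ha, ord_algebraMap_mul_factorProd (hne j) hc₀,
        Finsupp.notMem_support_iff.1 fun hmem => hj (hm α hα hα0 j hmem)]
      rfl
    rw [eq_sub_of_add_eq he.symm]
    exact ord_sub_nonneg (hne j) (ord_constOp_nonneg (hne j) c n
      (ord_euler_div_self_nonneg (hne j) h0)) (ord_algebraMap_nonneg (hne j) e)
  have hpole : ¬ 0 ≤ ord α r := by
    intro h0
    have h1 : ord α (dlog a) = (-1 : ℤ) := by
      refine ord_euler_div_self hα0 ha0 ?_
      rw [ha, ord_algebraMap_mul_factorProd hα0 hc₀]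
      exact_mod_cast Finsupp.mem_support_iff.1 hα
    have h2 := ord_constOp_neg hα0 c n h1 hc
    rw [he] at h2
    exact absurd (ord_add_nonneg hα0 h0 (ord_algebraMap_nonneg hα0 e)) (not_le.2 h2)
  -- Where `τ(h) - h` is regular, `h` has a pole at `qʲα` exactly when it has one at `qʲ⁺¹α`.
  have hiff : ∀ j : ℤ, j ≠ 0 → (j ∈ S ↔ j + 1 ∈ S) := by
    intro j hj
    rw [← not_iff_not]
    simp only [hS, Set.mem_ofPred_eq, not_lt]
    rw [← hτ]
    constructor
    · intro h1
      rw [show qShift q h = h + r by rw [hr]; ring]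
      exact ord_add_nonneg (hne j) h1 (hreg j hj)
    · intro h1
      rw [show h = qShift q h - r by rw [hr]; ring]
      exact ord_sub_nonneg (hne j) h1 (hreg j hj)
  -- The pole of `τ(h) - h` at `α` forces `1 ∈ S` or `0 ∈ S`; the first spreads to all positive
  -- indices, the second to all nonpositive ones.
  by_cases h1 : (1 : ℤ) ∈ S
  · have hall : ∀ k : ℕ, (k : ℤ) + 1 ∈ S := by
      intro k
      induction k with
      | zero => simpa using h1
      | succ k ih =>
        push_cast
        exact (hiff _ (by omega)).1 ih
    exact Set.infinite_of_injective_forall_mem (f := fun k : ℕ => (k : ℤ) + 1)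
      (fun a b hab => by simpa using hab) hall hSfin
  · have h0 : (0 : ℤ) ∈ S := by
      by_contra h0
      apply hpole
      simp only [hS, Set.mem_ofPred_eq, not_lt] at h0 h1
      have h2 := hτ 0
      rw [zero_add] at h2
      rw [← h2] at h1
      rw [zpow_zero, one_mul] at h0 h1
      exact ord_sub_nonneg hα0 h1 h0
    have hall : ∀ k : ℕ, -(k : ℤ) ∈ S := by
      intro k
      induction k with
      | zero => simpa using h0
      | succ k ih =>
        refine (hiff _ (by omega)).2 ?_
        convert ih using 1
        push_cast
        ring
    exact Set.infinite_of_injective_forall_mem (f := fun k : ℕ => -(k : ℤ))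
      (fun a b hab => by simpa using hab) hall hSfin

/-- Induction on the number of nonzero points in the support. If two lie in one orbit, a twist
merges them without affecting telescoping; otherwise only a power of `x` is left. -/
theorem isTwist_of_isTelescoping_aux {q : ℂˣ} (hq : 1 < ‖(q : ℂ)‖) {c : ℕ → ℂ} {n : ℕ}
    (hc : ∃ i < n, c i ≠ 0) {c₀ : ℂ} (hc₀ : c₀ ≠ 0) (N : ℕ) (m : ℂ →₀ ℤ)
    (hN : (m.support.erase 0).card ≤ N)
    (h : IsTelescoping q c n (algebraMap ℂ MeroField c₀ * factorProd m)) :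
    IsTwist q (algebraMap ℂ MeroField c₀ * factorProd m) := by
  induction N using Nat.strong_induction_on generalizing m with
  | _ N ih =>
  by_cases hm : ∀ α ∈ m.support, α ≠ 0 → ∀ j : ℤ, (q : ℂ) ^ j * α ∈ m.support → j = 0
  · have hsub := support_subset_of_isTelescoping hq hc hc₀ hm h
    have hm0 : m = Finsupp.single 0 (m 0) := by
      rw [Finsupp.support_subset_singleton] at hsub
      exact hsub
    rw [hm0, factorProd_single, map_zero, sub_zero]
    exact ⟨1, one_mem _, one_ne_zero, m 0, c₀, hc₀, by simp⟩
  · push Not at hm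
    obtain ⟨α, hα, hα0, j, hj, hj0⟩ := hm
    set β := (q : ℂ) ^ j * α with hβ
    have hαβ : β ≠ α := by
      intro h'
      apply hj0
      refine zpow_mul_injective hq hα0 ?_
      simpa using h'
    -- Adding `d` carries the whole exponent at `α` over to `β`.
    set d : ℂ →₀ ℤ := Finsupp.single β (m α) + -Finsupp.single α (m α) with hd
    have htw : IsTwist q (factorProd d) := by
      rw [hd, factorProd_add, factorProd_neg, factorProd_single, factorProd_single, ← div_eq_mul_inv,
        ← div_zpow]
      exact (IsTwist.X_sub_zpow_mul_div q α j).zpow _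
    have hcm : algebraMap ℂ MeroField c₀ * factorProd m ≠ 0 :=
      mul_ne_zero ((map_ne_zero _).2 hc₀) (factorProd_ne_zero m)
    have hsub : (m + d).support.erase 0 ⊆ (m.support.erase 0).erase α := by
      intro γ hγ
      rw [Finset.mem_erase, Finsupp.mem_support_iff] at hγ
      have hγα : γ ≠ α := by
        rintro rfl
        apply hγ.2
        simp [hd, hαβ]
      refine Finset.mem_erase.2 ⟨hγα, Finset.mem_erase.2 ⟨hγ.1, ?_⟩⟩
      by_cases hγβ : γ = β
      · rw [hγβ]; exact hj
      · rw [Finsupp.mem_support_iff]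
        have h2 := hγ.2
        simpa [hd, Finsupp.single_apply, Ne.symm hγα, Ne.symm hγβ] using h2
    have hαe : α ∈ m.support.erase 0 := Finset.mem_erase.2 ⟨hα0, hα⟩
    have hlt : ((m + d).support.erase 0).card < N :=
      (Finset.card_le_card hsub).trans_lt ((Finset.card_erase_lt_of_mem hαe).trans_le hN)
    have h1 := ih _ hlt (m + d) le_rfl (by
      rw [factorProd_add, ← mul_assoc]
      exact h.mul_of_isTwist hcm htw (factorProd_ne_zero d))
    rw [factorProd_add, ← mul_assoc] at h1
    have h2 := h1.mul htw.inv
    rwa [mul_inv_cancel_right₀ (factorProd_ne_zero d)] at h2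

/-- A rational function whose logarithmic derivative telescopes under a nonzero operator with
constant coefficients is a twist. -/
theorem isTwist_of_isTelescoping {q : ℂˣ} (hq : 1 < ‖(q : ℂ)‖) {c : ℕ → ℂ} {n : ℕ}
    (hc : ∃ i < n, c i ≠ 0) {a : MeroField} (ha : a ∈ ratField) (ha0 : a ≠ 0)
    (h : IsTelescoping q c n a) : IsTwist q a := by
  obtain ⟨c₀, m, hc₀, rfl⟩ := exists_eq_factorProd ha ha0
  exact isTwist_of_isTelescoping_aux hq hc hc₀ _ m le_rfl h

/-! ### Differential algebraicity and twists. -/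

theorem iterate_euler_mem_algClosureAdjoin {T : Set MeroField}
    (hT : ∀ t ∈ T, euler t ∈ algClosureAdjoin ℂ T) {y : MeroField}
    (hy : y ∈ algClosureAdjoin ℂ T) (n : ℕ) : euler^[n] y ∈ algClosureAdjoin ℂ T := by
  induction n with
  | zero => exact hy
  | succ n ih =>
    rw [Function.iterate_succ_apply']
    exact euler.apply_mem_algClosureAdjoin hT ih

/-- If `∂ʲz` is algebraic over `K` and the lower derivatives, then adding `z, …, ∂ʲ⁻¹z` to `T` gives
a finite set whose closure is stable under `∂`. The base field `K` is thereby replaced by `ℂ`. -/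
theorem exists_mem_algClosureAdjoin_of_isDifferentiallyAlgebraic {K : Type} [Field K]
    [Algebra K MeroField] {T : Set MeroField} (hTfin : T.Finite)
    (hT : ∀ t ∈ T, euler t ∈ algClosureAdjoin ℂ T)
    (hK : ∀ r : K, algebraMap K MeroField r ∈ algClosureAdjoin ℂ T) {z : MeroField}
    (hz : IsDifferentiallyAlgebraic K z) :
    ∃ S : Set MeroField, S.Finite ∧ (∀ s ∈ S, euler s ∈ algClosureAdjoin ℂ S) ∧
      z ∈ algClosureAdjoin ℂ S := by
  obtain ⟨n, hn⟩ := hz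
  obtain ⟨j, -, hj⟩ := exists_isAlgebraic_adjoin_of_not_algebraicIndependent
    (v := fun i => euler^[i] z) hn
  set V := (fun i => euler^[i] z) '' Set.Iio j with hV
  have hle : algClosureAdjoin ℂ T ≤ algClosureAdjoin ℂ (T ∪ V) :=
    algClosureAdjoin_le (Set.subset_union_left.trans (subset_algClosureAdjoin _))
  have hsub : V ⊆ algClosureAdjoin ℂ (T ∪ V) :=
    Set.subset_union_right.trans (subset_algClosureAdjoin _)
  have hzj : euler^[j] z ∈ algClosureAdjoin ℂ (T ∪ V) := by
    refine mem_algClosureAdjoin_of_isAlgebraic Subtype.val_injective (fun r => ?_) hj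
    obtain ⟨r, hr⟩ := r
    change r ∈ algClosureAdjoin ℂ (T ∪ V)
    induction hr using Algebra.adjoin_induction with
    | mem x hx => exact hsub hx
    | algebraMap r => exact hle (hK r)
    | add x y _ _ hx hy => exact add_mem hx hy
    | mul x y _ _ hx hy => exact mul_mem hx hy
  have hzi : ∀ i ≤ j, euler^[i] z ∈ algClosureAdjoin ℂ (T ∪ V) := by
    intro i hi
    rcases hi.eq_or_lt with rfl | hi
    · exact hzj
    · exact hsub ⟨i, hi, rfl⟩
  refine ⟨T ∪ V, hTfin.union ((Set.finite_Iio j).image _), ?_, hzi 0 (Nat.zero_le j)⟩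
  rintro s (hs | ⟨i, hi, rfl⟩)
  · exact hle (hT s hs)
  · have := hzi (i + 1) hi
    rwa [Function.iterate_succ_apply'] at this

theorem not_algebraicIndependent_of_forall_mem {K : Type} [Field K] [Algebra K MeroField]
    (φ : ℂ →+* K) (hφ : ∀ c, algebraMap K MeroField (φ c) = algebraMap ℂ MeroField c)
    {T : Set MeroField} (hT : T.Finite) {n : ℕ} (hn : T.ncard < n) {v : Fin n → MeroField}
    (hv : ∀ i, v i ∈ algClosureAdjoin ℂ T) : ¬ AlgebraicIndependent K v := by
  intro h
  let := φ.toAlgebra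
  have : IsScalarTower ℂ K MeroField := IsScalarTower.of_algebraMap_eq fun c => (hφ c).symm
  have h1 : AlgebraicIndependent ℂ v := h.restrictScalars φ.injective
  have h2 := h1.card_le_of_mem_algClosureAdjoin hv
  rw [← hT.cast_ncard_eq, Nat.cast_le] at h2
  omega

theorem isDifferentiallyAlgebraic_of_forall_mem {K : Type} [Field K] [Algebra K MeroField]
    (φ : ℂ →+* K) (hφ : ∀ c, algebraMap K MeroField (φ c) = algebraMap ℂ MeroField c)
    {T : Set MeroField} (hTfin : T.Finite) (hT : ∀ t ∈ T, euler t ∈ algClosureAdjoin ℂ T)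
    {z : MeroField} (hz : z ∈ algClosureAdjoin ℂ T) : IsDifferentiallyAlgebraic K z :=
  ⟨T.ncard, not_algebraicIndependent_of_forall_mem φ hφ hTfin (Nat.lt_succ_self _) fun i =>
    iterate_euler_mem_algClosureAdjoin hT hz i⟩

theorem ratField_le_algClosureAdjoin {T : Set MeroField} (hX : X ∈ algClosureAdjoin ℂ T) :
    ratField ≤ algClosureAdjoin ℂ T :=
  IntermediateField.adjoin_le_iff.2 (Set.singleton_subset_iff.2 hX)

theorem ellipticRatField_subset_algClosureAdjoin {q : ℂˣ} {T : Set MeroField}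
    (hX : X ∈ algClosureAdjoin ℂ T) (hk : ∀ g ∈ ellipticField q, g ∈ algClosureAdjoin ℂ T)
    {r : MeroField} (hr : r ∈ ellipticRatField q) : r ∈ algClosureAdjoin ℂ T := by
  have hpoly : ∀ p : Polynomial (ellipticField q),
      Polynomial.aeval X p ∈ algClosureAdjoin ℂ T := fun p => by
    rw [Polynomial.aeval_eq_sum_range]
    refine sum_mem fun i _ => ?_
    rw [Algebra.smul_def]
    exact mul_mem (hk _ (p.coeff i).2) (pow_mem hX i)
  obtain ⟨p, s, rfl⟩ := (IntermediateField.mem_adjoin_simple_iff (ellipticField q) r).1 hr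
  exact div_mem (hpoly p) (hpoly s)

/-- The automorphism `τ` on the field `ℂ(x)`. -/
noncomputable def ratShift (q : ℂˣ) : ratField →+* ratField :=
  ((qShift q : MeroField →+* MeroField).comp (algebraMap ratField MeroField)).codRestrict ratField
    fun r => qShift_mem_ratField q r.2

theorem isTwist_of_mem_algClosureAdjoin {q : ℂˣ} (hq : 1 < ‖(q : ℂ)‖) {a z : MeroField}
    (ha : a ∈ ratField) (ha0 : a ≠ 0) (hz0 : z ≠ 0) (hz : qShift q z = a * z) {T : Set MeroField}
    (hTfin : T.Finite) (hT : ∀ t ∈ T, euler t ∈ algClosureAdjoin ℂ T)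
    (hzT : z ∈ algClosureAdjoin ℂ T) : IsTwist q a := by
  have : CharZero ratField := charZero_of_injective_algebraMap (algebraMap ℂ ratField).injective
  have hu : dlog z ∈ algClosureAdjoin ℂ T :=
    div_mem (euler.apply_mem_algClosureAdjoin hT hzT) hzT
  have hτu : qShift q (dlog z) = dlog z + dlog a := by
    rw [← dlog_qShift, hz, dlog_mul ha0 hz0, add_comm]
  -- One function more than the transcendence degree over `ℂ` can accommodate; dependence over `ℂ`
  -- gives dependence over `ℂ(x)`.
  set N := T.ncard + 1 with hN
  let b : Fin N → ratField := fun i =>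
    ⟨euler^[i] (dlog a), iterate_euler_mem_ratField (dlog_mem_ratField ha) i⟩
  have hdep : ¬ AlgebraicIndependent ratField fun i : Fin N => euler^[i] (dlog z) :=
    not_algebraicIndependent_of_forall_mem (algebraMap ℂ ratField) (fun _ => rfl) hTfin
      (Nat.lt_succ_self _) fun i => iterate_euler_mem_algClosureAdjoin hT hu i
  obtain ⟨c, ⟨i₀, hi₀⟩, hc, h, hsum⟩ := exists_linear_of_not_algebraicIndependent (ratShift q)
    (qShift q : MeroField →+* MeroField) (fun _ => rfl) b (fun i : Fin N => euler^[i] (dlog z))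
    (fun i => by
      change qShift q (euler^[i] (dlog z)) = euler^[i] (dlog z) + euler^[i] (dlog a)
      rw [← iterate_euler_qShift, hτu, iterate_euler_add]) hdep
  have hconst : ∀ i, ∃ e : ℂ, (c i : MeroField) = algebraMap ℂ MeroField e := fun i =>
    exists_eq_algebraMap_of_mem_ratField hq (c i).2 (congrArg Subtype.val (hc i))
  choose e he using hconst
  -- `constOp` takes coefficients indexed by `ℕ`; only those below `N` enter.
  let e' : ℕ → ℂ := fun i => if hi : i < N then e ⟨i, hi⟩ else 0
  have he' : ∀ i : Fin N, e' i = e i := fun i => dif_pos i.2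
  refine isTwist_of_isTelescoping hq (c := e') (n := N) ⟨i₀, i₀.2, ?_⟩ ha ha0
    ⟨h, h.2, 0, ?_⟩
  · rw [he']
    intro h0
    apply hi₀
    apply Subtype.val_injective
    rw [he, h0, RingHom.map_zero]
    rfl
  · rw [constOp, ← Fin.sum_univ_eq_sum_range
      (fun i => algebraMap ℂ MeroField (e' i) * euler^[i] (dlog a)) N, RingHom.map_zero, add_zero]
    have h1 : ((∑ i, c i * b i : ratField) : MeroField) = ((ratShift q h - h : ratField) : MeroField) :=
      congrArg Subtype.val hsum
    rw [IntermediateField.coe_sum] at h1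
    refine Eq.trans (Finset.sum_congr rfl fun i _ => ?_) h1
    rw [he', ← he]
    rfl

theorem exists_mem_algClosureAdjoin_of_isTwist {q : ℂˣ} (hq : 1 < ‖(q : ℂ)‖) {a z : MeroField}
    (hz0 : z ≠ 0) (hz : qShift q z = a * z) (ha : IsTwist q a) :
    ∃ T : Set MeroField, T.Finite ∧ (∀ t ∈ T, euler t ∈ algClosureAdjoin ℂ T) ∧
      z ∈ algClosureAdjoin ℂ T := by
  obtain ⟨g, hg, hg0, n, c, hc, rfl⟩ := ha
  obtain ⟨f, hf, hk⟩ := exists_ellipticField_subset_algClosureAdjoin hq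
  have hc' : algebraMap ℂ MeroField c ≠ 0 := (map_ne_zero _).2 hc
  set w := z / g with hw
  have hw0 : w ≠ 0 := div_ne_zero hz0 hg0
  have hτw : qShift q w = algebraMap ℂ MeroField c * X ^ n * w := by
    have := qShift_ne_zero q hg0
    rw [hw, map_div₀, hz]
    field_simp
  have hτu : qShift q (dlog w) = dlog w + algebraMap ℂ MeroField n := by
    rw [← dlog_qShift, hτw, dlog_mul (mul_ne_zero hc' (zpow_ne_zero _ X_ne_zero)) hw0,
      dlog_mul hc' (zpow_ne_zero _ X_ne_zero), dlog_algebraMap, dlog_X_zpow]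
    ring
  have hv : euler (dlog w) ∈ ellipticField q := by
    rw [mem_ellipticField, ← euler_qShift, hτu, Derivation.map_add, euler_algebraMap, add_zero]
  -- `f` accounts for all elliptic functions, among them `∂f` and `∂(dlog w)`; `X` for `g` in `z = w
  -- g`; and `∂w = w · dlog w`.
  set T : Set MeroField := {f, X, dlog w, w} with hT
  have hmem : ∀ t ∈ T, t ∈ algClosureAdjoin ℂ T := fun t ht => subset_algClosureAdjoin T ht
  have hkT : ∀ g ∈ ellipticField q, g ∈ algClosureAdjoin ℂ T := fun g hg =>
    algClosureAdjoin_le (Set.singleton_subset_iff.2 (hmem f (by simp [hT]))) (hk g hg)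
  refine ⟨T, by simp [hT], ?_, ?_⟩
  · rintro t (rfl | rfl | rfl | rfl)
    · exact hkT _ (euler_mem_ellipticField hf)
    · rw [euler_X]
      exact hmem _ (by simp [hT])
    · exact hkT _ hv
    · rw [← mul_div_cancel₀ (euler w) hw0]
      exact mul_mem (hmem _ (by simp [hT])) (hmem (dlog w) (by simp [hT]))
  · rw [show z = w * g from (div_mul_cancel₀ z hg0).symm]
    exact mul_mem (hmem _ (by simp [hT]))
      (ratField_le_algClosureAdjoin (hmem X (by simp [hT])) hg)

theorem isDifferentiallyAlgebraic_ratField_iff_isTwist {q : ℂˣ} (hq : 1 < ‖(q : ℂ)‖)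
    {a z : MeroField} (ha : a ∈ ratField) (ha0 : a ≠ 0) (hz0 : z ≠ 0)
    (hz : qShift q z = a * z) : IsDifferentiallyAlgebraic ratField z ↔ IsTwist q a := by
  constructor
  · intro h
    obtain ⟨S, hSfin, hS, hzS⟩ := exists_mem_algClosureAdjoin_of_isDifferentiallyAlgebraic
      (Set.finite_singleton X) (fun t ht => by
        rw [Set.mem_singleton_iff.1 ht, euler_X]
        exact subset_algClosureAdjoin _ rfl)
      (fun r => ratField_le_algClosureAdjoin
        (subset_algClosureAdjoin {X} (Set.mem_singleton X)) r.2) h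
    exact isTwist_of_mem_algClosureAdjoin hq ha ha0 hz0 hz hSfin hS hzS
  · intro h
    obtain ⟨T, hTfin, hT, hzT⟩ := exists_mem_algClosureAdjoin_of_isTwist hq hz0 hz h
    exact isDifferentiallyAlgebraic_of_forall_mem (algebraMap ℂ ratField) (fun _ => rfl) hTfin hT hzT

theorem isDifferentiallyAlgebraic_ellipticRatField_iff_isTwist {q : ℂˣ} (hq : 1 < ‖(q : ℂ)‖)
    {a z : MeroField} (ha : a ∈ ratField) (ha0 : a ≠ 0) (hz0 : z ≠ 0)
    (hz : qShift q z = a * z) : IsDifferentiallyAlgebraic (ellipticRatField q) z ↔ IsTwist q a := by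
  constructor
  · intro h
    obtain ⟨f, hf, hk⟩ := exists_ellipticField_subset_algClosureAdjoin hq
    have hfT : f ∈ algClosureAdjoin ℂ ({f, X} : Set MeroField) :=
      subset_algClosureAdjoin _ (by simp)
    have hXT : X ∈ algClosureAdjoin ℂ ({f, X} : Set MeroField) :=
      subset_algClosureAdjoin _ (by simp)
    have hkT : ∀ g ∈ ellipticField q, g ∈ algClosureAdjoin ℂ ({f, X} : Set MeroField) :=
      fun g hg => algClosureAdjoin_le (Set.singleton_subset_iff.2 hfT) (hk g hg)
    obtain ⟨S, hSfin, hS, hzS⟩ := exists_mem_algClosureAdjoin_of_isDifferentiallyAlgebraic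
      (T := {f, X}) (by simp) (by
        rintro t (rfl | rfl)
        · exact hkT _ (euler_mem_ellipticField hf)
        · rw [euler_X]; exact hXT)
      (fun r => ellipticRatField_subset_algClosureAdjoin hXT hkT r.2) h
    exact isTwist_of_mem_algClosureAdjoin hq ha ha0 hz0 hz hSfin hS hzS
  · intro h
    obtain ⟨T, hTfin, hT, hzT⟩ := exists_mem_algClosureAdjoin_of_isTwist hq hz0 hz h
    exact isDifferentiallyAlgebraic_of_forall_mem
      ((algebraMap ℂ MeroField).codRestrict (ellipticRatField q) fun c =>
        (ellipticRatField q).algebraMap_mem ⟨_, algebraMap_mem_ellipticField q c⟩)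
      (fun _ => rfl) hTfin hT hzT

/-! ### Solutions that are meromorphic at the origin. -/

theorem X_pow (n : ℕ) : X ^ n = mk (fun x => x ^ n) (MeromorphicOn.id.pow n) := by
  induction n with
  | zero =>
    rw [pow_zero, ← RingHom.map_one (algebraMap ℂ MeroField), algebraMap_eq_mk]
    congr 1
  | succ n ih =>
    rw [pow_succ, ih, X, mk_mul]
    congr 1

theorem X_zpow (n : ℤ) : X ^ n = mk (fun x => x ^ n) (MeromorphicOn.id.zpow n) := by
  obtain ⟨k, rfl | rfl⟩ := n.eq_nat_or_neg
  · rw [zpow_natCast, X_pow]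
    congr 1
  · rw [zpow_neg, zpow_natCast, X_pow, mk_inv]
    congr 1
    ext x
    simp

theorem IsMeromorphicOnPlane.div {y z : MeroField} (hy : IsMeromorphicOnPlane y)
    (hz : IsMeromorphicOnPlane z) : IsMeromorphicOnPlane (y / z) := by
  obtain ⟨f, hf, rfl⟩ := hy
  obtain ⟨g, hg, rfl⟩ := hz
  refine ⟨f * g⁻¹, hf.mul hg.inv, ?_⟩
  rw [div_eq_mul_inv, mk_inv, mk_mul]

theorem isMeromorphicOnPlane_of_mem_ratField {g : MeroField} (hg : g ∈ ratField) :
    IsMeromorphicOnPlane g := by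
  have hmero : ∀ p : Polynomial ℂ, Meromorphic fun x => p.eval x := fun p x => by
    have : AnalyticAt ℂ (fun x => p.eval x) x := by
      simpa using AnalyticAt.aeval_polynomial (analyticAt_id (𝕜 := ℂ) (z := x)) p
    exact this.meromorphicAt
  have hpoly : ∀ p : Polynomial ℂ,
      Polynomial.aeval X p = mk (fun x => p.eval x) (hmero p).meromorphicOn := by
    intro p
    induction p using Polynomial.induction_on' with
    | add p r ihp ihr =>
      rw [Polynomial.aeval_add, ihp, ihr, mk_add]
      congr 1
      ext x
      simp
    | monomial n a =>
      rw [Polynomial.aeval_monomial, algebraMap_eq_mk, X_pow, mk_mul]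
      congr 1
      ext x
      simp
  obtain ⟨r, s, rfl⟩ := mem_ratField_iff.1 hg
  exact IsMeromorphicOnPlane.div ⟨_, hmero r, hpoly r⟩ ⟨_, hmero s, hpoly s⟩

/-- Equality in `F` lets exceptional points accumulate at `0`. Meromorphy at `0` excludes this:
otherwise `f` would be nonzero throughout a punctured neighbourhood of `0`, hence near some `p ≠ 0`.
-/
theorem eventually_nhdsNE_zero_of_codiscreteWithin {f : ℂ → ℂ} (hf : MeromorphicAt f 0)
    (h : ∀ᶠ x in codiscreteWithin ({0}ᶜ : Set ℂ), f x = 0) : ∀ᶠ x in 𝓝[≠] 0, f x = 0 := by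
  rcases hf.eventually_eq_zero_or_eventually_ne_zero with h0 | h0
  · exact h0
  · obtain ⟨p, hp, hp0⟩ := ((eventually_eventually_nhdsWithin.2 h0).and self_mem_nhdsWithin).exists
    rw [isOpen_compl_singleton.nhdsWithin_eq hp0] at hp
    obtain ⟨y, hy, hy'⟩ := ((hp.filter_mono nhdsWithin_le_nhds).and
      (eventually_nhdsNE_of_codiscreteWithin h hp0)).exists
    exact absurd hy' hy

/-- A solution of `w(qx) = c xⁿ w(x)` that is meromorphic at `0` exists only for `n = 0` and
`c ∈ q^ℤ`. -/
theorem eq_zero_and_exists_zpow_of_isMeromorphicOnPlane {q : ℂˣ} {w : MeroField} (hw0 : w ≠ 0)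
    (hw : IsMeromorphicOnPlane w) {n : ℤ} {c : ℂ} (hc : c ≠ 0)
    (h : qShift q w = algebraMap ℂ MeroField c * X ^ n * w) :
    n = 0 ∧ ∃ m : ℤ, c = (q : ℂ) ^ m := by
  obtain ⟨W, hW, rfl⟩ := hw
  have hWq : MeromorphicAt (fun x => W (q * x)) 0 :=
    MeromorphicAt.comp_analyticAt (g := fun x : ℂ => (q : ℂ) * x) (hW _) (by fun_prop)
  have hWc : MeromorphicAt (fun x => c * x ^ n * W x) 0 :=
    ((MeromorphicAt.const c 0).mul (MeromorphicAt.id 0 |>.zpow n)).mul (hW 0)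
  have heq : ∀ᶠ x in 𝓝[≠] (0 : ℂ), W (q * x) = c * x ^ n * W x := by
    rw [qShift_mk, X_zpow, algebraMap_eq_mk, mk_mul, mk_mul, mk_eq_mk] at h
    refine (eventually_nhdsNE_zero_of_codiscreteWithin (hWq.sub hWc) ?_).mono fun x hx =>
      sub_eq_zero.1 hx
    exact h.mono fun x hx => sub_eq_zero.2 hx
  have htop : meromorphicOrderAt W 0 ≠ ⊤ := by
    have h1 : meromorphicOrderAt W 1 ≠ ⊤ := by
      rw [← ord_mk one_ne_zero hW.meromorphicOn]
      exact ord_ne_top one_ne_zero hw0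
    exact (hW.meromorphicOn (s := Set.univ)).meromorphicOrderAt_ne_top_of_isPreconnected
      isPreconnected_univ (Set.mem_univ 1) (Set.mem_univ 0) h1
  obtain ⟨k, hk⟩ : ∃ k : ℤ, meromorphicOrderAt W 0 = k := ⟨_, (WithTop.coe_untop _ htop).symm⟩
  obtain ⟨G, hG, hG0, hWG⟩ := (meromorphicOrderAt_eq_int_iff (hW 0)).1 hk
  have hcont : ContinuousAt (fun x : ℂ => (q : ℂ) * x) 0 := by fun_prop
  have ht : Tendsto (fun x : ℂ => (q : ℂ) * x) (𝓝[≠] 0) (𝓝[≠] 0) := by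
    refine tendsto_nhdsWithin_iff.2 ⟨?_, ?_⟩
    · have := hcont.tendsto
      rw [mul_zero] at this
      exact this.mono_left nhdsWithin_le_nhds
    · filter_upwards [self_mem_nhdsWithin] with y hy
      exact mul_ne_zero q.ne_zero hy
  have hGq : Tendsto (fun x : ℂ => G (q * x)) (𝓝[≠] 0) (𝓝 (G 0)) :=
    (hG.continuousAt.tendsto.mono_left nhdsWithin_le_nhds).comp ht
  have hGt : Tendsto G (𝓝[≠] 0) (𝓝 (G 0)) := hG.continuousAt.tendsto.mono_left nhdsWithin_le_nhds
  -- Write `W = xᵏ G` with `G(0) ≠ 0` and cancel `xᵏ`. Once `n = 0` is known, letting `x → 0` yields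
  -- `qᵏ = c`.
  have hrel : ∀ᶠ x in 𝓝[≠] (0 : ℂ), (q : ℂ) ^ k * G (q * x) = c * x ^ n * G x := by
    filter_upwards [heq, hWG, ht.eventually hWG, self_mem_nhdsWithin] with x h1 h2 h3 hx
    rw [h2, h3] at h1
    simp only [sub_zero, smul_eq_mul, mul_zpow] at h1
    have hxk : x ^ k ≠ 0 := zpow_ne_zero _ hx
    apply mul_left_cancel₀ hxk
    linear_combination h1
  have hn : n = 0 := by
    have h1 : meromorphicOrderAt (fun x => W (q * x)) 0 = k := by
      have := meromorphicOrderAt_comp_of_deriv_ne_zero (f := W) (g := fun x : ℂ => (q : ℂ) * x)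
        (x := 0) (by fun_prop) (by simp)
      rw [mul_zero, hk] at this
      exact this
    have h2 : meromorphicOrderAt (fun x => c * x ^ n * W x) 0 = (n + k : ℤ) := by
      rw [meromorphicOrderAt_eq_int_iff hWc]
      refine ⟨fun x => c * G x, analyticAt_const.mul hG, mul_ne_zero hc hG0, ?_⟩
      filter_upwards [hWG, self_mem_nhdsWithin] with x hx hx0
      rw [hx, sub_zero, smul_eq_mul, smul_eq_mul, zpow_add₀ hx0]
      ring
    rw [meromorphicOrderAt_congr heq, h2, WithTop.coe_inj] at h1
    omega
  subst hn
  refine ⟨rfl, k, ?_⟩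
  simp only [zpow_zero, mul_one] at hrel
  have h3 := tendsto_nhds_unique ((hGq.const_mul _).congr' hrel) (hGt.const_mul c)
  exact (mul_right_cancel₀ hG0 h3).symm

end MeroField

/-! ### The main theorem. -/

theorem corollary6p5 (q : ℂˣ) (hq : 1 < ‖(q : ℂ)‖) (a z : MeroField)
    (ha : a ∈ MeroField.ratField) (ha0 : a ≠ 0) (hz0 : z ≠ 0) (hz : MeroField.qShift q z = a * z) :
    (MeroField.IsDifferentiallyAlgebraic MeroField.ratField z ↔
      MeroField.IsDifferentiallyAlgebraic (MeroField.ellipticRatField q) z) ∧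
    (MeroField.IsDifferentiallyAlgebraic MeroField.ratField z ↔
      ∃ g ∈ MeroField.ratField, g ≠ 0 ∧ ∃ (n : ℤ) (c : ℂ),
        a = algebraMap ℂ MeroField c * MeroField.X ^ n * (MeroField.qShift q g / g)) ∧
    (MeroField.IsMeromorphicOnPlane z →
      (MeroField.IsDifferentiallyAlgebraic MeroField.ratField z ↔
        ∃ g ∈ MeroField.ratField, g ≠ 0 ∧ ∃ c : ℂ, (∃ m : ℤ, c = (q : ℂ) ^ m) ∧
          a = algebraMap ℂ MeroField c * (MeroField.qShift q g / g)) ∧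
      ∀ g ∈ MeroField.ratField, g ≠ 0 → ∀ (n : ℤ) (c : ℂ),
        a = algebraMap ℂ MeroField c * MeroField.X ^ n * (MeroField.qShift q g / g) →
        n = 0 ∧ ∃ m : ℤ, c = (q : ℂ) ^ m) := by
  have hrat := MeroField.isDifferentiallyAlgebraic_ratField_iff_isTwist hq ha ha0 hz0 hz
  have hell := MeroField.isDifferentiallyAlgebraic_ellipticRatField_iff_isTwist hq ha ha0 hz0 hz
  -- The theorem lets `c` be any complex number, whereas `IsTwist` asks for `c ≠ 0`; the two agree
  -- because `a ≠ 0`.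
  have hconst : ∀ (n : ℤ) (c : ℂ) (y : MeroField),
      a = algebraMap ℂ MeroField c * MeroField.X ^ n * y → c ≠ 0 := by
    rintro n c y h rfl
    apply ha0
    rw [h, RingHom.map_zero, zero_mul, zero_mul]
  have hrep : MeroField.IsMeromorphicOnPlane z → ∀ g ∈ MeroField.ratField, g ≠ 0 →
      ∀ (n : ℤ) (c : ℂ),
        a = algebraMap ℂ MeroField c * MeroField.X ^ n * (MeroField.qShift q g / g) →
        n = 0 ∧ ∃ m : ℤ, c = (q : ℂ) ^ m := by
    intro hmer g hg hg0 n c h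
    refine MeroField.eq_zero_and_exists_zpow_of_isMeromorphicOnPlane (w := z / g)
      (div_ne_zero hz0 hg0) (hmer.div (MeroField.isMeromorphicOnPlane_of_mem_ratField hg))
      (hconst n c _ h) ?_
    have := MeroField.qShift_ne_zero q hg0
    rw [map_div₀, hz, h]
    field_simp
  refine ⟨hrat.trans hell.symm, hrat.trans ⟨?_, ?_⟩, fun hmer => ⟨hrat.trans ⟨?_, ?_⟩, hrep hmer⟩⟩
  · rintro ⟨g, hg, hg0, n, c, -, h⟩
    exact ⟨g, hg, hg0, n, c, h⟩
  · rintro ⟨g, hg, hg0, n, c, h⟩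
    exact ⟨g, hg, hg0, n, c, hconst n c _ h, h⟩
  · rintro ⟨g, hg, hg0, n, c, -, h⟩
    obtain ⟨rfl, hm⟩ := hrep hmer g hg hg0 n c h
    rw [zpow_zero, mul_one] at h
    exact ⟨g, hg, hg0, c, hm, h⟩
  · rintro ⟨g, hg, hg0, c, -, h⟩
    have h' : a = algebraMap ℂ MeroField c * MeroField.X ^ (0 : ℤ) * (MeroField.qShift q g / g) := by
      rw [zpow_zero, mul_one, h]
    exact ⟨g, hg, hg0, 0, c, hconst 0 c _ h', h'⟩
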